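/- Let $\Lambda>0$ and $m>0$ with $3m\sqrt{\Lambda}<1$, let $r_c$ be the largest positive root of $\frac{\Lambda r^2}{3}+\frac{2m}{r}-1$, and consider the expanding region $\mathcal{R}^+=\{(t,r,\omega): t\in\mathbb{R},\ r>r_c,\ \omega\in\mathbb{S}^2\}$ of Schwarzschild de Sitter with the metric $$g=-\phi^2\,dr^2+\bar g_r,\qquad \bar g_r=\Bigl(\frac{\Lambda r^2}{3}+\frac{2m}{r}-1\Bigr)dt^2+r^2\gamma,\qquad \phi=\Bigl(\frac{\Lambda r^2}{3}+\frac{2m}{r}-1\Bigr)^{-1/2},$$ where $\gamma$ is the standard metric on the unit sphere $\mathbb{S}^2$. Let $\Sigma_r$ denote the level sets of $r$ in $\mathcal{R}^+$, with induced metric $\bar g_r$ and volume measure $d\mu_{\bar g_r}$, and let $|\nabla\!\!\!\!/\,\psi|$ be the norm of the gradient of $\psi$ along the spheres of constant $(t,r)$, with respect to the metric $r^2\gamma$. Let $\psi$ be a real-valued $C^2$ solution of the wave equation $\Box_g\psi=0$ on $\mathcal{R}^+$. Then for all $r_2>r_1>r_c$, $$\int_{\Sigma_{r_2}}\Bigl\{\frac{1}{\phi^2}(\partial_r\psi)^2+\phi^2(\partial_t\psi)^2+|\nabla\!\!\!\!/\,\psi|^2\Bigr\}\phi\,d\mu_{\bar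 g_{r_2}}\ \le\ \int_{\Sigma_{r_1}}\Bigl\{\frac{1}{\phi^2}(\partial_r\psi)^2+\phi^2(\partial_t\psi)^2+|\nabla\!\!\!\!/\,\psi|^2\Bigr\}\phi\,d\mu_{\bar g_{r_1}},$$ as an inequality in $[0,\infty]$; in particular the left side is finite whenever the right side is. -/

import Mathlib

open MeasureTheory
open scoped ENNReal

namespace SdS

noncomputable section

/-- Euclidean three-space. -/
abbrev E3 : Type := EuclideanSpace ℝ (Fin 3)

/-- The expanding region is described in a single global chart: the point with coordinates
`(t, r, ω)`, `ω` in the unit sphere, is represented by `(t, x)` with `x = r ω`. -/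
abbrev Spacetime : Type := ℝ × E3

/-- The area radius `r = |x|`. -/
def radius (p : Spacetime) : ℝ := ‖p.2‖

/-- The function `Λ r² / 3 + 2 m / r - 1`. -/
def warp (Λ m r : ℝ) : ℝ := Λ * r ^ 2 / 3 + 2 * m / r - 1

/-- The area radius of the cosmological horizon: the largest positive root of
`Λ r² / 3 + 2 m / r - 1`. -/
def cosmologicalRadius (Λ m : ℝ) : ℝ := sSup {r : ℝ | 0 < r ∧ warp Λ m r = 0}

/-- The expanding region `r > r_c`. -/
def expandingRegion (Λ m : ℝ) : Set Spacetime := {p | cosmologicalRadius Λ m < radius p}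

/-- The lapse function of the foliation by the level sets of `r`. -/
def lapse (Λ m r : ℝ) : ℝ := 1 / √(warp Λ m r)

/-- The coordinate vector field `∂_t`. -/
def vecT : Spacetime := (1, 0)

/-- The coordinate vector field `∂_r` (at constant `t` and `ω`). -/
def vecR (p : Spacetime) : Spacetime := (0, (radius p)⁻¹ • p.2)

/-- The differential `dt`. -/
def dT (v : Spacetime) : ℝ := v.1

/-- The differential `dr` at `p`. -/
def dR (p v : Spacetime) : ℝ := inner ℝ p.2 v.2 / radius p

/-- The symmetric form `r² γ` at `p`, where `γ` is the standard metric of the unit sphere; in the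
present chart the Euclidean metric of three-space is `dr² + r² γ`. -/
def sphereForm (p v w : Spacetime) : ℝ := inner ℝ v.2 w.2 - dR p v * dR p w

/-- The Schwarzschild de Sitter metric
`g = - φ² dr² + (Λ r² / 3 + 2 m / r - 1) dt² + r² γ`. -/
def metric (Λ m : ℝ) (p v w : Spacetime) : ℝ :=
  -(lapse Λ m (radius p)) ^ 2 * (dR p v * dR p w)
    + warp Λ m (radius p) * (dT v * dT w) + sphereForm p v w

/-- The coordinate basis `∂_0 = ∂_t, ∂_1, ∂_2, ∂_3` of the chart `(t, x)`. -/
def frame : Fin 4 → Spacetime :=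
  Fin.cons (1, 0) (fun i : Fin 3 => (0, EuclideanSpace.single i 1))

/-- The components `g_{μν}`. -/
def metricMatrix (Λ m : ℝ) (p : Spacetime) : Matrix (Fin 4) (Fin 4) ℝ :=
  Matrix.of fun μ ν => metric Λ m p (frame μ) (frame ν)

/-- The coordinate derivative `∂_μ u`. -/
def partialDeriv (μ : Fin 4) (u : Spacetime → ℝ) (p : Spacetime) : ℝ := fderiv ℝ u p (frame μ)

/-- The wave operator
`□_g ψ = |det g|^{-1/2} ∂_μ (|det g|^{1/2} g^{μν} ∂_ν ψ)`. -/
def waveOperator (Λ m : ℝ) (ψ : Spacetime → ℝ) (p : Spacetime) : ℝ :=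
  (√|(metricMatrix Λ m p).det|)⁻¹ *
    ∑ μ : Fin 4, partialDeriv μ
      (fun q => √|(metricMatrix Λ m q).det| *
        ∑ ν : Fin 4, (metricMatrix Λ m q)⁻¹ μ ν * partialDeriv ν ψ q) p

/-- Classical solutions of `□_g ψ = 0` on the expanding region. -/
structure IsWaveSolution (Λ m : ℝ) (ψ : Spacetime → ℝ) : Prop where
  contDiffOn : ContDiffOn ℝ 2 ψ (expandingRegion Λ m)
  wave_eq : ∀ p ∈ expandingRegion Λ m, waveOperator Λ m ψ p = 0

/-- The angular gradient: the projection of the gradient of `ψ` to the tangent space `x^⊥` of the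
sphere of area radius `r = |x|` through `p = (t, x)`. On vectors tangent to that sphere, `g` is the
Euclidean inner product, so the norm of this vector is its norm in the induced metric. -/
def angularGradient (ψ : Spacetime → ℝ) (p : Spacetime) : E3 :=
  (ℝ ∙ p.2)ᗮ.starProjection (gradient (fun x : E3 => ψ (p.1, x)) p.2)

/-- The density `φ⁻² (∂_r ψ)² + φ² (∂_t ψ)² + |∇̸ψ|²`. -/
def energyDensity (Λ m : ℝ) (ψ : Spacetime → ℝ) (p : Spacetime) : ℝ :=
  1 / (lapse Λ m (radius p)) ^ 2 * (fderiv ℝ ψ p (vecR p)) ^ 2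
    + (lapse Λ m (radius p)) ^ 2 * (fderiv ℝ ψ p vecT) ^ 2
    + ‖angularGradient ψ p‖ ^ 2

/-- The volume measure of the metric `(Λ r² / 3 + 2 m / r - 1) dt² + r² γ` induced on the level
set `Σ_r`, as a measure on the spacetime carried by `Σ_r`: the image under `(t, ω) ↦ (t, r ω)` of
`(Λ r² / 3 + 2 m / r - 1)^{1/2} r² dt dσ(ω)`, with `σ` the surface measure of the unit sphere. -/
def sliceVolume (Λ m r : ℝ) : Measure Spacetime :=
  Measure.map (fun q : ℝ × Metric.sphere (0 : E3) 1 => (q.1, r • (q.2 : E3)))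
    (ENNReal.ofReal (√(warp Λ m r) * r ^ 2) •
      (volume : Measure ℝ).prod (volume : Measure E3).toSphere)

/-- The energy `∫_{Σ_r} { φ⁻² (∂_r ψ)² + φ² (∂_t ψ)² + |∇̸ψ|² } φ dμ`, with values in `[0, ∞]`. -/
def energy (Λ m : ℝ) (ψ : Spacetime → ℝ) (r : ℝ) : ℝ≥0∞ :=
  ∫⁻ p, ENNReal.ofReal (energyDensity Λ m ψ p * lapse Λ m (radius p)) ∂(sliceVolume Λ m r)

/-- In the subextremal range the largest positive root exists. -/
theorem isGreatest_cosmologicalRadius {Λ m : ℝ} (hΛ : 0 < Λ) (hm : 0 < m)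
    (hsub : 3 * m * √Λ < 1) :
    IsGreatest {r : ℝ | 0 < r ∧ warp Λ m r = 0} (cosmologicalRadius Λ m) := by
  have hs : 0 < √Λ := Real.sqrt_pos.2 hΛ
  have hss : √Λ * √Λ = Λ := Real.mul_self_sqrt hΛ.le
  have hset : {r : ℝ | 0 < r ∧ warp Λ m r = 0}
      = {r : ℝ | 2 * m ≤ r ∧ Λ * r ^ 3 - 3 * r + 6 * m = 0} := by
    ext r
    simp only [Set.mem_ofPred_eq, warp]
    constructor
    · rintro ⟨h0, h⟩
      have h1 : Λ * r ^ 3 - 3 * r + 6 * m = 0 := by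
        field_simp at h
        linarith
      refine ⟨?_, h1⟩
      have : 0 < Λ * r ^ 3 := by positivity
      linarith
    · rintro ⟨h0, h⟩
      have hr : 0 < r := by linarith
      refine ⟨hr, ?_⟩
      field_simp
      linarith
  rw [cosmologicalRadius, hset]
  set S : Set ℝ := {r : ℝ | 2 * m ≤ r ∧ Λ * r ^ 3 - 3 * r + 6 * m = 0} with hS
  have hclosed : IsClosed S :=
    (isClosed_le continuous_const continuous_id).inter
      (isClosed_eq (by fun_prop) continuous_const)
  have hbdd : BddAbove S := by
    refine ⟨3 / Λ + 1, ?_⟩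
    rintro r ⟨h0, h⟩
    have hr : 0 < r := by linarith
    have h2 : Λ * r ^ 2 < 3 := by
      by_contra! hc
      nlinarith
    by_contra! hc
    have h4 : 3 < Λ * r := by
      have : 3 / Λ < r := by linarith
      rwa [div_lt_iff₀ hΛ, mul_comm] at this
    have h5 : 1 < r := by
      have : 0 < 3 / Λ := by positivity
      linarith
    nlinarith
  have hne : S.Nonempty := by
    have hcont : ContinuousOn (fun r : ℝ => Λ * r ^ 3 - 3 * r + 6 * m)
        (Set.Icc (1 / √Λ) (2 / √Λ)) := by fun_prop
    have hle : 1 / √Λ ≤ 2 / √Λ := by gcongr; norm_num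
    have ha : Λ * (1 / √Λ) ^ 3 - 3 * (1 / √Λ) + 6 * m ≤ 0 := by
      have : Λ * (1 / √Λ) ^ 3 = 1 / √Λ := by
        field_simp
        nlinarith
      rw [this]
      have h3 : 3 * m < 1 / √Λ := by rwa [lt_div_iff₀ hs]
      linarith
    have hb : 0 ≤ Λ * (2 / √Λ) ^ 3 - 3 * (2 / √Λ) + 6 * m := by
      have : Λ * (2 / √Λ) ^ 3 = 8 / √Λ := by
        field_simp
        nlinarith
      rw [this]
      have : 8 / √Λ - 3 * (2 / √Λ) = 2 / √Λ := by ring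
      have h3 : 0 < 2 / √Λ := by positivity
      linarith
    obtain ⟨r, hr, h⟩ := intermediate_value_Icc hle hcont ⟨ha, hb⟩
    refine ⟨r, ?_, h⟩
    have h3 : 3 * m < 1 / √Λ := by rwa [lt_div_iff₀ hs]
    linarith [hr.1]
  exact hclosed.isGreatest_csSup hne hbdd

end

end SdS

namespace SdS

noncomputable section

/-! Write F for `warp` and e for `energyDensity`. Since φ √F = 1, the energy is r² ∫ e dt dσ, with
no weight beyond the Euclidean one. In the chart (t, x) the metric has determinant -1, so the wave
equation says that the Euclidean divergence of the gradient `flux` vanishes.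

Contracting the stress-energy tensor with ∂_r gives `current`, whose radial component is -e/2
(`sum_unitRadial_mul_current`). Its divergence contains no angular derivatives: it is (rF' -
2F)/(2rF²) (∂_t ψ)² + (F'/2 + F/r) (∂_r ψ)² (`sum_partialDeriv_current`). Both coefficients are
nonnegative for r > r_c, because r_c lies beyond the photon sphere: rF' - 2F = 2(r - 3m)/r and r_c ≥
1/√Λ > 3m. The divergence theorem then makes the energy nonincreasing in r.

The slices are unbounded in t and the energy may be infinite, so the current is cut off to |t| ≤ R -
C r with C = 1/F(r₁). Light rays satisfy |dt/dr| ≤ 1/F ≤ C for r ≥ r₁, so the cutoff terms have a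
favourable sign (`neg_le_sum_partialDeriv_cutoff`). Testing against a radial function ζ replaces
boundary terms by a distributional inequality (`integral_deriv_mul_energyDensity_nonneg`), which
continuity in r turns into a pointwise one (`le_of_forall_integral_deriv_mul_nonneg`). Monotone
convergence as R → ∞ removes the cutoff. -/

/-! ### The function F beyond the cosmological horizon. -/

theorem one_div_sqrt_le_cosmologicalRadius {Λ m : ℝ} (hΛ : 0 < Λ) (hm : 0 < m)
    (hsub : 3 * m * √Λ < 1) : 1 / √Λ ≤ cosmologicalRadius Λ m := by
  have hs : 0 < √Λ := Real.sqrt_pos.2 hΛ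
  have hss : √Λ * √Λ = Λ := Real.mul_self_sqrt hΛ.le
  have hcont : ContinuousOn (fun r : ℝ => Λ * r ^ 3 - 3 * r + 6 * m)
      (Set.Icc (1 / √Λ) (2 / √Λ)) := by fun_prop
  -- The cubic equals 6m - 2/√Λ at this endpoint, so its sign is the subextremality condition.
  have ha : Λ * (1 / √Λ) ^ 3 - 3 * (1 / √Λ) + 6 * m ≤ 0 := by
    have h : Λ * (1 / √Λ) ^ 3 = 1 / √Λ := by
      field_simp
      nlinarith
    have h3 : 3 * m < 1 / √Λ := by rwa [lt_div_iff₀ hs]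
    linarith
  have hb : 0 ≤ Λ * (2 / √Λ) ^ 3 - 3 * (2 / √Λ) + 6 * m := by
    have h : Λ * (2 / √Λ) ^ 3 = 4 * (2 / √Λ) := by
      field_simp
      nlinarith
    have h3 : 0 < 2 / √Λ := by positivity
    linarith
  obtain ⟨r, hr, h⟩ := intermediate_value_Icc (by gcongr; norm_num) hcont ⟨ha, hb⟩
  have hr0 : 0 < r := lt_of_lt_of_le (by positivity) hr.1
  refine hr.1.trans ((isGreatest_cosmologicalRadius hΛ hm hsub).2 ⟨hr0, ?_⟩)
  simp only at h
  rw [warp]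
  field_simp
  linarith

theorem cosmologicalRadius_pos {Λ m : ℝ} (hΛ : 0 < Λ) (hm : 0 < m)
    (hsub : 3 * m * √Λ < 1) : 0 < cosmologicalRadius Λ m :=
  (isGreatest_cosmologicalRadius hΛ hm hsub).1.1

/-- The photon sphere r = 3m lies inside the horizon; the sign of the (∂_t ψ)² term in the
divergence rests on this. -/
theorem three_mul_lt_cosmologicalRadius {Λ m : ℝ} (hΛ : 0 < Λ) (hm : 0 < m)
    (hsub : 3 * m * √Λ < 1) : 3 * m < cosmologicalRadius Λ m := by
  refine lt_of_lt_of_le ?_ (one_div_sqrt_le_cosmologicalRadius hΛ hm hsub)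
  rwa [lt_div_iff₀ (Real.sqrt_pos.2 hΛ)]

theorem one_le_mul_sq_of_cosmologicalRadius_le {Λ m r : ℝ} (hΛ : 0 < Λ) (hm : 0 < m)
    (hsub : 3 * m * √Λ < 1) (hr : cosmologicalRadius Λ m ≤ r) : 1 ≤ Λ * r ^ 2 := by
  have h := (one_div_sqrt_le_cosmologicalRadius hΛ hm hsub).trans hr
  have hs : 0 < √Λ := Real.sqrt_pos.2 hΛ
  rw [div_le_iff₀ hs] at h
  have h2 : (r * √Λ) ^ 2 = Λ * r ^ 2 := by rw [mul_pow, Real.sq_sqrt hΛ.le]; ring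
  nlinarith

theorem warp_strictMonoOn {Λ m : ℝ} (hΛ : 0 < Λ) (hm : 0 < m) (hsub : 3 * m * √Λ < 1) :
    StrictMonoOn (warp Λ m) (Set.Ici (cosmologicalRadius Λ m)) := by
  intro r hr s hs hrs
  have h3 := three_mul_lt_cosmologicalRadius hΛ hm hsub
  have hr' : cosmologicalRadius Λ m ≤ r := hr
  have hr1 := one_le_mul_sq_of_cosmologicalRadius_le hΛ hm hsub hr'
  have hr0 : 0 < r := by linarith
  have hs0 : 0 < s := by linarith
  -- As Λ r² ≥ 1 and s > r, the second factor is at least 2s - 6m, which is positive since s > 3m.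
  have key : warp Λ m s - warp Λ m r
      = (s - r) * (Λ * r ^ 2 * s + Λ * r * s ^ 2 - 6 * m) / (3 * r * s) := by
    simp only [warp]
    field_simp
    ring
  have h1 : s ≤ Λ * r ^ 2 * s := le_mul_of_one_le_left hs0.le hr1
  have h2 : Λ * r ^ 2 * s ≤ Λ * r * s ^ 2 := by
    have : Λ * r * s * r ≤ Λ * r * s * s := by gcongr
    nlinarith
  have : 0 < warp Λ m s - warp Λ m r := by
    rw [key]
    refine div_pos (mul_pos (by linarith) (by linarith)) (by positivity)
  linarith

theorem warp_pos {Λ m r : ℝ} (hΛ : 0 < Λ) (hm : 0 < m) (hsub : 3 * m * √Λ < 1)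
    (hr : cosmologicalRadius Λ m < r) : 0 < warp Λ m r := by
  rw [← (isGreatest_cosmologicalRadius hΛ hm hsub).1.2]
  exact warp_strictMonoOn hΛ hm hsub Set.self_mem_Ici hr.le hr

/-- The derivative of `warp` with respect to the radius. -/
def warpDeriv (Λ m r : ℝ) : ℝ := 2 * Λ * r / 3 - 2 * m / r ^ 2

theorem hasDerivAt_warp {Λ m r : ℝ} (hr : r ≠ 0) :
    HasDerivAt (warp Λ m) (warpDeriv Λ m r) r := by
  have h := ((((hasDerivAt_id r).pow 2).const_mul (Λ / 3)).add
    ((hasDerivAt_inv hr).const_mul (2 * m))).sub_const 1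
  refine (h.congr_deriv ?_).congr_of_eventuallyEq (.of_forall fun s => ?_)
  · simp [warpDeriv]
    ring
  · simp [warp]
    ring

theorem warpDeriv_pos {Λ m r : ℝ} (hΛ : 0 < Λ) (hm : 0 < m) (hsub : 3 * m * √Λ < 1)
    (hr : cosmologicalRadius Λ m < r) : 0 < warpDeriv Λ m r := by
  have h3 := three_mul_lt_cosmologicalRadius hΛ hm hsub
  have h1 := one_le_mul_sq_of_cosmologicalRadius_le hΛ hm hsub hr.le
  have hr0 : 0 < r := by linarith
  have : warpDeriv Λ m r = 2 * (r * (Λ * r ^ 2) - 3 * m) / (3 * r ^ 2) := by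
    rw [warpDeriv]
    field_simp
  rw [this]
  have : r ≤ r * (Λ * r ^ 2) := le_mul_of_one_le_right hr0.le h1
  exact div_pos (by linarith) (by positivity)

/-- Beyond the photon sphere `r = 3 m`, the function `F / r²` is nondecreasing. -/
theorem two_mul_warp_le {Λ m r : ℝ} (hΛ : 0 < Λ) (hm : 0 < m) (hsub : 3 * m * √Λ < 1)
    (hr : cosmologicalRadius Λ m < r) : 2 * warp Λ m r ≤ r * warpDeriv Λ m r := by
  have h3 := three_mul_lt_cosmologicalRadius hΛ hm hsub
  have hr0 : 0 < r := by linarith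
  have : r * warpDeriv Λ m r - 2 * warp Λ m r = 2 * (r - 3 * m) / r := by
    simp only [warp, warpDeriv]
    field_simp
    ring
  have : 0 ≤ 2 * (r - 3 * m) / r := div_nonneg (by linarith) hr0.le
  linarith

theorem isOpen_expandingRegion (Λ m : ℝ) : IsOpen (expandingRegion Λ m) :=
  isOpen_lt continuous_const (continuous_norm.comp continuous_snd)

theorem lapse_sq {Λ m r : ℝ} (h : 0 < warp Λ m r) : lapse Λ m r ^ 2 = (warp Λ m r)⁻¹ := by
  rw [lapse, div_pow, Real.sq_sqrt h.le, one_pow, one_div]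

/-! ### The metric in the chart (t, x): inverse and determinant. -/

/-- The components of the unit radial vector. -/
def unitRadial (i : Fin 3) (p : Spacetime) : ℝ := p.2 i / radius p

theorem sum_unitRadial_sq {p : Spacetime} (hp : 0 < radius p) :
    ∑ i, unitRadial i p ^ 2 = 1 := by
  have h : radius p ^ 2 = ∑ i, p.2 i ^ 2 := by
    rw [radius, EuclideanSpace.real_norm_sq_eq]
  simp only [unitRadial, div_pow, ← Finset.sum_div, ← h]
  exact div_self (by positivity)

theorem frame_zero : frame 0 = (1, 0) := rfl

theorem frame_succ (i : Fin 3) : frame i.succ = (0, EuclideanSpace.single i 1) := rfl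

theorem dR_frame_zero (p : Spacetime) : dR p (frame 0) = 0 := by simp [dR, frame_zero]

theorem dR_frame_succ (p : Spacetime) (i : Fin 3) : dR p (frame i.succ) = unitRadial i p := by
  simp [dR, frame_succ, unitRadial, EuclideanSpace.inner_single_right]

/-- The contravariant components of the metric. -/
def inverseMetric (Λ m : ℝ) (p : Spacetime) : Matrix (Fin 4) (Fin 4) ℝ :=
  Matrix.of <| Fin.cons (Fin.cons (warp Λ m (radius p))⁻¹ fun _ => 0) fun i =>
    Fin.cons 0 fun j => (if i = j then 1 else 0)
      - (1 + warp Λ m (radius p)) * (unitRadial i p * unitRadial j p)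

theorem metricMatrix_eq {Λ m : ℝ} {p : Spacetime} (h : 0 < warp Λ m (radius p)) :
    metricMatrix Λ m p = Matrix.of (Fin.cons (Fin.cons (warp Λ m (radius p)) fun _ => 0) fun i =>
    Fin.cons 0 fun j => (if i = j then 1 else 0)
      - (1 + (warp Λ m (radius p))⁻¹) * (unitRadial i p * unitRadial j p)) := by
  ext μ ν
  refine Fin.cases ?_ (fun i => ?_) μ <;> refine Fin.cases ?_ (fun j => ?_) ν
  · simp only [metricMatrix, metric, sphereForm, dR_frame_zero, Matrix.of_apply]
    simp [frame_zero, dT]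
  · simp only [metricMatrix, metric, sphereForm, dR_frame_zero, Matrix.of_apply]
    simp [frame_zero, frame_succ, dT]
  · simp only [metricMatrix, metric, sphereForm, dR_frame_zero, Matrix.of_apply]
    simp [frame_zero, frame_succ, dT]
  · simp only [metricMatrix, metric, sphereForm, dR_frame_succ, lapse_sq h, Matrix.of_apply]
    simp [frame_succ, dT, EuclideanSpace.inner_single_left, eq_comm]
    ring

/-- With n the unit radial vector, the spatial blocks I - (1 + 1/F) nnᵀ and I - (1 + F) nnᵀ are the
identity on n^⊥ and have eigenvalues -1/F and -F on n. -/
theorem metricMatrix_mul_inverseMetric {Λ m : ℝ} {p : Spacetime} (hp : 0 < radius p)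
    (h : 0 < warp Λ m (radius p)) : metricMatrix Λ m p * inverseMetric Λ m p = 1 := by
  have hn := sum_unitRadial_sq hp
  have hF : warp Λ m (radius p) * (warp Λ m (radius p))⁻¹ = 1 := mul_inv_cancel₀ h.ne'
  rw [metricMatrix_eq h, inverseMetric]
  generalize (warp Λ m (radius p))⁻¹ = G at hF
  generalize warp Λ m (radius p) = F at hF
  ext μ ν
  refine Fin.cases ?_ (fun i => ?_) μ <;> refine Fin.cases ?_ (fun j => ?_) ν
  · simp [Matrix.mul_apply, Fin.sum_univ_succ, hF]
  · rw [Matrix.mul_apply, Fin.sum_univ_succ, Matrix.one_apply_ne (Fin.succ_ne_zero j).symm]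
    simp
  · rw [Matrix.mul_apply, Fin.sum_univ_succ, Matrix.one_apply_ne (Fin.succ_ne_zero i)]
    simp
  · rw [Matrix.mul_apply, Fin.sum_univ_succ]
    simp only [Matrix.of_apply, Fin.cons_succ, Fin.cons_zero, Matrix.one_apply, Fin.succ_inj]
    rw [Fin.sum_univ_three] at hn ⊢
    have hij : ((if i = 0 then (1 : ℝ) else 0) * (if (0 : Fin 3) = j then 1 else 0)
        + (if i = 1 then 1 else 0) * (if 1 = j then 1 else 0)
        + (if i = 2 then 1 else 0) * (if 2 = j then 1 else 0)) = if i = j then 1 else 0 := by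
      fin_cases i <;> fin_cases j <;> simp
    have hi : (if i = 0 then (1 : ℝ) else 0) * unitRadial 0 p
        + (if i = 1 then 1 else 0) * unitRadial 1 p
        + (if i = 2 then 1 else 0) * unitRadial 2 p = unitRadial i p := by
      fin_cases i <;> simp
    have hj : unitRadial 0 p * (if (0 : Fin 3) = j then 1 else 0)
        + unitRadial 1 p * (if 1 = j then 1 else 0)
        + unitRadial 2 p * (if 2 = j then 1 else 0) = unitRadial j p := by
      fin_cases j <;> simp
    linear_combination hij - (1 + F) * unitRadial j p * hi - (1 + G) * unitRadial i p * hj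
      + (1 + F) * (1 + G) * unitRadial i p * unitRadial j p * hn
      + unitRadial i p * unitRadial j p * hF

theorem inv_metricMatrix {Λ m : ℝ} {p : Spacetime} (hp : 0 < radius p)
    (h : 0 < warp Λ m (radius p)) : (metricMatrix Λ m p)⁻¹ = inverseMetric Λ m p :=
  Matrix.inv_eq_right_inv (metricMatrix_mul_inverseMetric hp h)

/-- The t-direction contributes F, the radial one -1/F and the tangential ones 1. The volume density
therefore drops out of the wave operator. -/
theorem det_metricMatrix {Λ m : ℝ} {p : Spacetime} (hp : 0 < radius p)
    (h : 0 < warp Λ m (radius p)) : (metricMatrix Λ m p).det = -1 := by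
  have hn := sum_unitRadial_sq hp
  have hF : warp Λ m (radius p) * (warp Λ m (radius p))⁻¹ = 1 := mul_inv_cancel₀ h.ne'
  rw [metricMatrix_eq h]
  generalize (warp Λ m (radius p))⁻¹ = G at *
  generalize warp Λ m (radius p) = F at *
  rw [Matrix.det_succ_row_zero, Fin.sum_univ_succ]
  have hM : ∀ A : Fin 3 → Fin 3 → ℝ, (Matrix.of (Fin.cons (Fin.cons F fun _ => 0) fun i =>
      Fin.cons 0 (A i)) : Matrix (Fin 4) (Fin 4) ℝ).submatrix Fin.succ (Fin.succAbove 0)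
      = Matrix.of A := by
    intro A
    ext i j
    simp
  rw [hM, Matrix.det_fin_three]
  rw [Fin.sum_univ_three] at hn
  simp
  linear_combination -F * (1 + G) * hn - hF

/-! ### Coordinate derivatives of the radius and of the unit radial vector. -/

theorem hasFDerivAt_radius {p : Spacetime} (hp : 0 < radius p) :
    HasFDerivAt radius ((radius p)⁻¹ • (innerSL ℝ p.2 ∘L ContinuousLinearMap.snd ℝ ℝ E3)) p := by
  have h := ((hasFDerivAt_snd (𝕜 := ℝ) (p := p)).norm_sq).sqrt (pow_ne_zero 2 hp.ne')
  have h2 : (fun q : Spacetime => √(‖q.2‖ ^ 2)) = radius := by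
    funext q
    exact Real.sqrt_sq (norm_nonneg _)
  rw [h2] at h
  refine h.congr_fderiv ?_
  ext v
  · simp
  · simp [radius]
    ring

theorem contDiffAt_radius {p : Spacetime} (hp : 0 < radius p) {n : WithTop ℕ∞} :
    ContDiffAt ℝ n radius p :=
  (contDiffAt_norm ℝ (norm_pos_iff.1 hp)).comp p contDiff_snd.contDiffAt

theorem contDiffAt_warp {Λ m : ℝ} {p : Spacetime} (hp : 0 < radius p) {n : WithTop ℕ∞} :
    ContDiffAt ℝ n (fun q => warp Λ m (radius q)) p := by
  have h := contDiffAt_radius hp (n := n)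
  unfold warp
  exact (((contDiffAt_const.mul (h.pow 2)).div_const _).add
    (contDiffAt_const.div h hp.ne')).sub contDiffAt_const

theorem contDiffAt_unitRadial {p : Spacetime} (hp : 0 < radius p) {n : WithTop ℕ∞} (i : Fin 3) :
    ContDiffAt ℝ n (unitRadial i) p :=
  ContDiffAt.div (by fun_prop) (contDiffAt_radius hp) hp.ne'

theorem partialDeriv_zero_radius {p : Spacetime} (hp : 0 < radius p) :
    partialDeriv 0 radius p = 0 := by
  simp [partialDeriv, (hasFDerivAt_radius hp).fderiv, frame_zero]

theorem partialDeriv_succ_radius {p : Spacetime} (hp : 0 < radius p) (i : Fin 3) :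
    partialDeriv i.succ radius p = unitRadial i p := by
  simp [partialDeriv, (hasFDerivAt_radius hp).fderiv, frame_succ, unitRadial,
    EuclideanSpace.inner_single_right]
  ring

section Calculus

variable {f g : Spacetime → ℝ} {p : Spacetime} (μ : Fin 4)

theorem partialDeriv_mul (hf : DifferentiableAt ℝ f p) (hg : DifferentiableAt ℝ g p) :
    partialDeriv μ (fun q => f q * g q) p
      = f p * partialDeriv μ g p + g p * partialDeriv μ f p := by
  simp [partialDeriv, fderiv_fun_mul hf hg]

theorem partialDeriv_add (hf : DifferentiableAt ℝ f p) (hg : DifferentiableAt ℝ g p) :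
    partialDeriv μ (fun q => f q + g q) p = partialDeriv μ f p + partialDeriv μ g p := by
  simp [partialDeriv, fderiv_fun_add hf hg]

theorem partialDeriv_sub (hf : DifferentiableAt ℝ f p) (hg : DifferentiableAt ℝ g p) :
    partialDeriv μ (fun q => f q - g q) p = partialDeriv μ f p - partialDeriv μ g p := by
  simp [partialDeriv, fderiv_fun_sub hf hg]

theorem partialDeriv_const_mul (c : ℝ) (hf : DifferentiableAt ℝ f p) :
    partialDeriv μ (fun q => c * f q) p = c * partialDeriv μ f p := by
  simp [partialDeriv, fderiv_const_mul hf]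

theorem partialDeriv_const_add (c : ℝ) :
    partialDeriv μ (fun q => c + f q) p = partialDeriv μ f p := by
  simp [partialDeriv, fderiv_const_add]

theorem partialDeriv_sum {ι : Type*} (s : Finset ι) {F : ι → Spacetime → ℝ}
    (hF : ∀ i ∈ s, DifferentiableAt ℝ (F i) p) :
    partialDeriv μ (fun q => ∑ i ∈ s, F i q) p = ∑ i ∈ s, partialDeriv μ (F i) p := by
  simp [partialDeriv, fderiv_fun_sum hF]

theorem partialDeriv_comp {h : ℝ → ℝ} {h' : ℝ} (hh : HasDerivAt h h' (f p))
    (hf : DifferentiableAt ℝ f p) :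
    partialDeriv μ (fun q => h (f q)) p = h' * partialDeriv μ f p := by
  have := hh.comp_hasFDerivAt p hf.hasFDerivAt
  simp only [partialDeriv]
  rw [show (fun q => h (f q)) = h ∘ f from rfl, this.fderiv]
  simp

theorem partialDeriv_congr (h : f =ᶠ[nhds p] g) : partialDeriv μ f p = partialDeriv μ g p := by
  simp only [partialDeriv, h.fderiv_eq]

end Calculus

theorem partialDeriv_zero_unitRadial {p : Spacetime} (hp : 0 < radius p) (i : Fin 3) :
    partialDeriv 0 (unitRadial i) p = 0 := by
  have hr := (contDiffAt_radius hp (n := 1)).differentiableAt one_ne_zero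
  have hi : DifferentiableAt ℝ (fun q : Spacetime => (fun r : ℝ => r⁻¹) (radius q)) p :=
    hr.inv hp.ne'
  have h : unitRadial i = fun q => q.2 i * (fun r : ℝ => r⁻¹) (radius q) := by
    funext q; simp [unitRadial, div_eq_mul_inv]
  have hx : HasFDerivAt (fun q : Spacetime => q.2 i)
      (EuclideanSpace.proj i ∘L ContinuousLinearMap.snd ℝ ℝ E3) p :=
    (EuclideanSpace.proj i ∘L ContinuousLinearMap.snd ℝ ℝ E3).hasFDerivAt
  rw [h, partialDeriv_mul 0 hx.differentiableAt hi,
    partialDeriv_comp 0 (hasDerivAt_inv hp.ne') hr, partialDeriv_zero_radius hp, partialDeriv,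
    hx.fderiv, frame_zero]
  simp

theorem partialDeriv_succ_unitRadial {p : Spacetime} (hp : 0 < radius p) (i j : Fin 3) :
    partialDeriv j.succ (unitRadial i) p
      = ((if i = j then 1 else 0) - unitRadial i p * unitRadial j p) / radius p := by
  have hr := (contDiffAt_radius hp (n := 1)).differentiableAt one_ne_zero
  have hi : DifferentiableAt ℝ (fun q : Spacetime => (fun r : ℝ => r⁻¹) (radius q)) p :=
    hr.inv hp.ne'
  have h : unitRadial i = fun q => q.2 i * (fun r : ℝ => r⁻¹) (radius q) := by
    funext q; simp [unitRadial, div_eq_mul_inv]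
  have hx : HasFDerivAt (fun q : Spacetime => q.2 i)
      (EuclideanSpace.proj i ∘L ContinuousLinearMap.snd ℝ ℝ E3) p :=
    (EuclideanSpace.proj i ∘L ContinuousLinearMap.snd ℝ ℝ E3).hasFDerivAt
  conv_lhs => rw [h]
  rw [partialDeriv_mul _ hx.differentiableAt hi,
    partialDeriv_comp _ (hasDerivAt_inv hp.ne') hr, partialDeriv_succ_radius hp, partialDeriv,
    hx.fderiv, frame_succ]
  simp [unitRadial]
  split_ifs <;> field_simp <;> ring

theorem contDiffAt_partialDeriv {ψ : Spacetime → ℝ} {p : Spacetime} (hψ : ContDiffAt ℝ 2 ψ p)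
    (μ : Fin 4) : ContDiffAt ℝ 1 (partialDeriv μ ψ) p :=
  (hψ.fderiv_right (m := 1) (by norm_num)).clm_apply contDiffAt_const

theorem partialDeriv_comm {ψ : Spacetime → ℝ} {p : Spacetime} (hψ : ContDiffAt ℝ 2 ψ p)
    (μ ν : Fin 4) :
    partialDeriv μ (partialDeriv ν ψ) p = partialDeriv ν (partialDeriv μ ψ) p := by
  have hd : DifferentiableAt ℝ (fderiv ℝ ψ) p :=
    (hψ.fderiv_right (m := 1) (by norm_num)).differentiableAt one_ne_zero
  have h : ∀ μ ν, partialDeriv μ (partialDeriv ν ψ) p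
      = fderiv ℝ (fderiv ℝ ψ) p (frame μ) (frame ν) := by
    intro μ ν
    unfold partialDeriv
    rw [fderiv_clm_apply hd (differentiableAt_const _)]
    simp
  rw [h, h]
  exact hψ.isSymmSndFDerivAt (by simp) _ _

/-! ### The energy current of the multiplier ∂_r and its divergence. -/

/-- The radial derivative `∂_r ψ`. -/
def radialDeriv (ψ : Spacetime → ℝ) (p : Spacetime) : ℝ :=
  ∑ i : Fin 3, unitRadial i p * partialDeriv i.succ ψ p

/-- The components of the gradient `g^{μν} ∂_ν ψ`. -/
def flux (Λ m : ℝ) (ψ : Spacetime → ℝ) : Fin 4 → Spacetime → ℝ :=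
  Fin.cons (fun q => (warp Λ m (radius q))⁻¹ * partialDeriv 0 ψ q) fun i q =>
    partialDeriv i.succ ψ q - (1 + warp Λ m (radius q)) * (radialDeriv ψ q * unitRadial i q)

/-- The Lagrangian density `g^{μν} ∂_μ ψ ∂_ν ψ`. -/
def lagrangian (Λ m : ℝ) (ψ : Spacetime → ℝ) (q : Spacetime) : ℝ :=
  (warp Λ m (radius q))⁻¹ * (partialDeriv 0 ψ q * partialDeriv 0 ψ q)
    + (∑ i : Fin 3, partialDeriv i.succ ψ q * partialDeriv i.succ ψ q)
    - (1 + warp Λ m (radius q)) * (radialDeriv ψ q * radialDeriv ψ q)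

/-- The energy current of the multiplier `∂_r`: the contraction of the stress-energy tensor
of `ψ` with `∂_r`. -/
def current (Λ m : ℝ) (ψ : Spacetime → ℝ) : Fin 4 → Spacetime → ℝ :=
  Fin.cons (fun q => radialDeriv ψ q * flux Λ m ψ 0 q) fun i q =>
    radialDeriv ψ q * flux Λ m ψ i.succ q - 1 / 2 * (lagrangian Λ m ψ q * unitRadial i q)

theorem sum_inverseMetric_mul (Λ m : ℝ) (ψ : Spacetime → ℝ) (μ : Fin 4) (q : Spacetime) :
    ∑ ν, inverseMetric Λ m q μ ν * partialDeriv ν ψ q = flux Λ m ψ μ q := by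
  refine Fin.cases ?_ (fun i => ?_) μ
  · simp [inverseMetric, flux, Fin.sum_univ_succ]
  · rw [Fin.sum_univ_succ]
    simp [inverseMetric, flux, sub_mul, Finset.sum_sub_distrib, radialDeriv, Finset.sum_mul,
      Finset.mul_sum]
    refine Finset.sum_congr rfl fun j _ => ?_
    ring

section Divergence

variable {Λ m : ℝ} {ψ : Spacetime → ℝ} {p : Spacetime}

theorem contDiffAt_radialDeriv (hψ : ContDiffAt ℝ 2 ψ p) (hp : 0 < radius p) :
    ContDiffAt ℝ 1 (radialDeriv ψ) p :=
  ContDiffAt.sum fun i _ => (contDiffAt_unitRadial hp i).mul (contDiffAt_partialDeriv hψ _)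

theorem contDiffAt_flux (hψ : ContDiffAt ℝ 2 ψ p) (hp : 0 < radius p)
    (hF : 0 < warp Λ m (radius p)) (μ : Fin 4) : ContDiffAt ℝ 1 (flux Λ m ψ μ) p := by
  refine Fin.cases ?_ (fun i => ?_) μ
  · exact ((contDiffAt_warp hp).inv hF.ne').mul (contDiffAt_partialDeriv hψ 0)
  · exact (contDiffAt_partialDeriv hψ i.succ).sub ((contDiffAt_const.add (contDiffAt_warp hp)).mul
      ((contDiffAt_radialDeriv hψ hp).mul (contDiffAt_unitRadial hp i)))

theorem contDiffAt_lagrangian (hψ : ContDiffAt ℝ 2 ψ p) (hp : 0 < radius p)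
    (hF : 0 < warp Λ m (radius p)) : ContDiffAt ℝ 1 (lagrangian Λ m ψ) p := by
  have h := contDiffAt_partialDeriv hψ
  have ha := contDiffAt_radialDeriv hψ hp
  exact ((((contDiffAt_warp hp).inv hF.ne').mul ((h 0).mul (h 0))).add
    (ContDiffAt.sum fun i _ => (h i.succ).mul (h i.succ))).sub
    ((contDiffAt_const.add (contDiffAt_warp hp)).mul (ha.mul ha))

theorem contDiffAt_current (hψ : ContDiffAt ℝ 2 ψ p) (hp : 0 < radius p)
    (hF : 0 < warp Λ m (radius p)) (μ : Fin 4) : ContDiffAt ℝ 1 (current Λ m ψ μ) p := by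
  have ha := contDiffAt_radialDeriv hψ hp
  refine Fin.cases ?_ (fun i => ?_) μ
  · exact ha.mul (contDiffAt_flux hψ hp hF 0)
  · exact (ha.mul (contDiffAt_flux hψ hp hF i.succ)).sub
      (contDiffAt_const.mul ((contDiffAt_lagrangian hψ hp hF).mul (contDiffAt_unitRadial hp i)))

theorem partialDeriv_radialDeriv (hψ : ContDiffAt ℝ 2 ψ p) (hp : 0 < radius p) (μ : Fin 4) :
    partialDeriv μ (radialDeriv ψ) p
      = ∑ i : Fin 3, (unitRadial i p * partialDeriv μ (partialDeriv i.succ ψ) p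
        + partialDeriv i.succ ψ p * partialDeriv μ (unitRadial i) p) := by
  have hn : ∀ i, DifferentiableAt ℝ (unitRadial i) p := fun i =>
    (contDiffAt_unitRadial hp (n := 1) i).differentiableAt one_ne_zero
  have h : ∀ μ, DifferentiableAt ℝ (partialDeriv μ ψ) p := fun μ =>
    (contDiffAt_partialDeriv hψ μ).differentiableAt one_ne_zero
  unfold radialDeriv
  rw [partialDeriv_sum μ _ fun i _ => (hn i).fun_mul (h i.succ)]
  exact Finset.sum_congr rfl fun i _ => partialDeriv_mul μ (hn i) (h i.succ)

theorem partialDeriv_succ_lagrangian (hψ : ContDiffAt ℝ 2 ψ p) (hp : 0 < radius p)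
    (hF : 0 < warp Λ m (radius p)) (j : Fin 3) :
    partialDeriv j.succ (lagrangian Λ m ψ) p
      = -(warpDeriv Λ m (radius p) * ((warp Λ m (radius p))⁻¹) ^ 2 * unitRadial j p
          * partialDeriv 0 ψ p ^ 2)
        + 2 * (warp Λ m (radius p))⁻¹ * partialDeriv 0 ψ p
          * partialDeriv j.succ (partialDeriv 0 ψ) p
        + 2 * ∑ i : Fin 3, partialDeriv i.succ ψ p * partialDeriv j.succ (partialDeriv i.succ ψ) p
        - warpDeriv Λ m (radius p) * unitRadial j p * radialDeriv ψ p ^ 2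
        - 2 * (1 + warp Λ m (radius p)) * radialDeriv ψ p
          * partialDeriv j.succ (radialDeriv ψ) p := by
  have h : ∀ μ, DifferentiableAt ℝ (partialDeriv μ ψ) p := fun μ =>
    (contDiffAt_partialDeriv hψ μ).differentiableAt one_ne_zero
  have hr := (contDiffAt_radius hp (n := 1)).differentiableAt one_ne_zero
  have ha := (contDiffAt_radialDeriv hψ hp).differentiableAt one_ne_zero
  have hw : DifferentiableAt ℝ (fun q => warp Λ m (radius q)) p :=
    (contDiffAt_warp hp (n := 1)).differentiableAt one_ne_zero
  have hw' : DifferentiableAt ℝ (fun q => 1 + warp Λ m (radius q)) p := hw.const_add 1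
  have hi : DifferentiableAt ℝ (fun q => (warp Λ m (radius q))⁻¹) p := hw.inv hF.ne'
  have hd : partialDeriv j.succ (fun q => warp Λ m (radius q)) p
      = warpDeriv Λ m (radius p) * unitRadial j p := by
    rw [partialDeriv_comp j.succ (hasDerivAt_warp hp.ne') hr, partialDeriv_succ_radius hp]
  have hdi : partialDeriv j.succ (fun q => (warp Λ m (radius q))⁻¹) p
      = -((warp Λ m (radius p))⁻¹) ^ 2 * (warpDeriv Λ m (radius p) * unitRadial j p) := by
    rw [partialDeriv_comp j.succ (hasDerivAt_inv hF.ne') hw, hd, inv_pow]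
  have hs : DifferentiableAt ℝ
      (fun q => ∑ i : Fin 3, partialDeriv i.succ ψ q * partialDeriv i.succ ψ q) p :=
    DifferentiableAt.fun_sum fun i _ => (h i.succ).fun_mul (h i.succ)
  unfold lagrangian
  rw [partialDeriv_sub _ ((hi.fun_mul ((h 0).fun_mul (h 0))).fun_add hs) (hw'.fun_mul (ha.fun_mul ha)),
    partialDeriv_add _ (hi.fun_mul ((h 0).fun_mul (h 0))) hs,
    partialDeriv_mul _ hi ((h 0).fun_mul (h 0)), partialDeriv_mul _ hw' (ha.fun_mul ha),
    partialDeriv_mul _ (h 0) (h 0), partialDeriv_mul _ ha ha, partialDeriv_const_add, hd, hdi,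
    partialDeriv_sum _ _ fun i _ => (h i.succ).fun_mul (h i.succ)]
  simp only [fun i : Fin 3 => partialDeriv_mul j.succ (h i.succ) (h i.succ), Finset.mul_sum,
    ← two_mul]
  ring

/-- Second derivatives of ψ cancel, by symmetry and by the wave equation `hV`. The divergence 2/r of
the unit radial vector contributes -1/r times the Lagrangian, while the derivative of n inside ∂_r ψ
contributes +1/r times the squared angular gradient; hence the angular terms cancel. The F' terms
come from differentiating the coefficients of the Lagrangian. -/
theorem sum_partialDeriv_current (hψ : ContDiffAt ℝ 2 ψ p) (hp : 0 < radius p)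
    (hF : 0 < warp Λ m (radius p)) (hV : ∑ μ, partialDeriv μ (flux Λ m ψ μ) p = 0) :
    ∑ μ, partialDeriv μ (current Λ m ψ μ) p
      = (radius p * warpDeriv Λ m (radius p) - 2 * warp Λ m (radius p))
          / (2 * radius p * warp Λ m (radius p) ^ 2) * partialDeriv 0 ψ p ^ 2
        + (warpDeriv Λ m (radius p) / 2 + warp Λ m (radius p) / radius p)
          * radialDeriv ψ p ^ 2 := by
  have ha := (contDiffAt_radialDeriv hψ hp).differentiableAt one_ne_zero
  have hn : ∀ i, DifferentiableAt ℝ (unitRadial i) p := fun i =>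
    (contDiffAt_unitRadial hp (n := 1) i).differentiableAt one_ne_zero
  have hf : ∀ μ, DifferentiableAt ℝ (flux Λ m ψ μ) p := fun μ =>
    (contDiffAt_flux hψ hp hF μ).differentiableAt one_ne_zero
  have hL := (contDiffAt_lagrangian (Λ := Λ) (m := m) hψ hp hF).differentiableAt one_ne_zero
  have h0 : partialDeriv 0 (current Λ m ψ 0) p
      = radialDeriv ψ p * partialDeriv 0 (flux Λ m ψ 0) p
        + flux Λ m ψ 0 p * partialDeriv 0 (radialDeriv ψ) p := partialDeriv_mul 0 ha (hf 0)
  have hi : ∀ i : Fin 3, partialDeriv i.succ (current Λ m ψ i.succ) p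
      = radialDeriv ψ p * partialDeriv i.succ (flux Λ m ψ i.succ) p
        + flux Λ m ψ i.succ p * partialDeriv i.succ (radialDeriv ψ) p
        - 1 / 2 * (lagrangian Λ m ψ p * partialDeriv i.succ (unitRadial i) p
          + unitRadial i p * partialDeriv i.succ (lagrangian Λ m ψ) p) := by
    intro i
    rw [← partialDeriv_mul i.succ ha (hf i.succ), ← partialDeriv_mul i.succ hL (hn i),
      ← partialDeriv_const_mul i.succ _ (hL.fun_mul (hn i)),
      ← partialDeriv_sub i.succ (ha.fun_mul (hf i.succ)) ((hL.fun_mul (hn i)).const_mul _)]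
    rfl
  rw [Fin.sum_univ_succ] at hV ⊢
  simp only [h0, hi, partialDeriv_succ_lagrangian hψ hp hF, partialDeriv_radialDeriv hψ hp,
    partialDeriv_zero_unitRadial hp, partialDeriv_succ_unitRadial hp]
  have hs := sum_unitRadial_sq hp
  have hf0 : flux Λ m ψ 0 p = (warp Λ m (radius p))⁻¹ * partialDeriv 0 ψ p := rfl
  have hfi : ∀ i : Fin 3, flux Λ m ψ i.succ p = partialDeriv i.succ ψ p
    - (1 + warp Λ m (radius p)) * (radialDeriv ψ p * unitRadial i p) := fun i => rfl
  simp only [hf0, hfi, lagrangian]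
  have hcomm := partialDeriv_comm hψ
  rw [div_eq_mul_inv _ (2 * radius p * warp Λ m (radius p) ^ 2)]
  simp only [div_eq_mul_inv, mul_inv, ← inv_pow]
  have hFG : warp Λ m (radius p) * (warp Λ m (radius p))⁻¹ = 1 := mul_inv_cancel₀ hF.ne'
  have hrr : radius p * (radius p)⁻¹ = 1 := mul_inv_cancel₀ hp.ne'
  generalize (warp Λ m (radius p))⁻¹ = G at *
  generalize warp Λ m (radius p) = F at *
  generalize warpDeriv Λ m (radius p) = F' at *
  generalize (radius p)⁻¹ = k at *
  generalize radius p = r at *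
  simp only [radialDeriv, Fin.sum_univ_three] at *
  simp only [hcomm (Fin.succ 0) 0, hcomm (Fin.succ 1) 0, hcomm (Fin.succ 2) 0,
    hcomm (Fin.succ 1) (Fin.succ 0), hcomm (Fin.succ 2) (Fin.succ 0),
    hcomm (Fin.succ 2) (Fin.succ 1), if_true, one_ne_zero, zero_ne_one, if_false, Fin.reduceEq]
  -- The wave equation enters multiplied by ∂_r ψ; the remaining coefficients account for |n|² = 1,
  -- r · r⁻¹ = 1 and F · F⁻¹ = 1.
  linear_combination (unitRadial 0 p * partialDeriv (Fin.succ 0) ψ p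
      + unitRadial 1 p * partialDeriv (Fin.succ 1) ψ p
      + unitRadial 2 p * partialDeriv (Fin.succ 2) ψ p) * hV
    + (1 / 2 * k * (G * partialDeriv 0 ψ p ^ 2
        + (partialDeriv (Fin.succ 0) ψ p ^ 2 + partialDeriv (Fin.succ 1) ψ p ^ 2
          + partialDeriv (Fin.succ 2) ψ p ^ 2)
        - (1 + F) * (unitRadial 0 p * partialDeriv (Fin.succ 0) ψ p
          + unitRadial 1 p * partialDeriv (Fin.succ 1) ψ p
          + unitRadial 2 p * partialDeriv (Fin.succ 2) ψ p) ^ 2)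
      + 1 / 2 * F' * G ^ 2 * partialDeriv 0 ψ p ^ 2
      + 1 / 2 * F' * (unitRadial 0 p * partialDeriv (Fin.succ 0) ψ p
          + unitRadial 1 p * partialDeriv (Fin.succ 1) ψ p
          + unitRadial 2 p * partialDeriv (Fin.succ 2) ψ p) ^ 2) * hs
    - 1 / 2 * F' * G ^ 2 * partialDeriv 0 ψ p ^ 2 * hrr + k * G * partialDeriv 0 ψ p ^ 2 * hFG

end Divergence

/-! ### The energy density as a flux, and positivity of the divergence. -/

section

variable {Λ m : ℝ} {ψ : Spacetime → ℝ} {p : Spacetime}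

/-- The determinant and inverse formulas hold throughout an open region, so they may be substituted
under the outer derivative. -/
theorem sum_partialDeriv_flux (hΛ : 0 < Λ) (hm : 0 < m) (hsub : 3 * m * √Λ < 1)
    (hψ : IsWaveSolution Λ m ψ) (hp : p ∈ expandingRegion Λ m) :
    ∑ μ, partialDeriv μ (flux Λ m ψ μ) p = 0 := by
  have hpos : ∀ q ∈ expandingRegion Λ m, 0 < radius q := fun q hq =>
    (cosmologicalRadius_pos hΛ hm hsub).trans hq
  have h := hψ.wave_eq p hp
  rw [waveOperator, det_metricMatrix (hpos p hp) (warp_pos hΛ hm hsub hp)] at h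
  simp only [abs_neg, abs_one, Real.sqrt_one, inv_one, one_mul] at h
  rw [← h]
  refine Finset.sum_congr rfl fun μ _ => partialDeriv_congr μ ?_
  filter_upwards [(isOpen_expandingRegion Λ m).mem_nhds hp] with q hq
  rw [det_metricMatrix (hpos q hq) (warp_pos hΛ hm hsub hq),
    inv_metricMatrix (hpos q hq) (warp_pos hΛ hm hsub hq), sum_inverseMetric_mul]
  simp

theorem fderiv_vecR (ψ : Spacetime → ℝ) (p : Spacetime) :
    fderiv ℝ ψ p (vecR p) = radialDeriv ψ p := by
  have h : vecR p = ∑ i : Fin 3, unitRadial i p • frame i.succ := by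
    ext i
    · simp [vecR, frame_succ, Prod.fst_sum]
    · simp only [vecR, frame_succ, Prod.snd_sum, Prod.smul_snd]
      fin_cases i <;> simp [Fin.sum_univ_three, unitRadial, div_eq_inv_mul]
  rw [h, map_sum]
  simp [radialDeriv, partialDeriv]

theorem fderiv_vecT (ψ : Spacetime → ℝ) (p : Spacetime) :
    fderiv ℝ ψ p vecT = partialDeriv 0 ψ p := rfl

theorem gradient_slice_apply (hψ : DifferentiableAt ℝ ψ p) (i : Fin 3) :
    gradient (fun x : E3 => ψ (p.1, x)) p.2 i = partialDeriv i.succ ψ p := by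
  have h1 : HasFDerivAt (fun x : E3 => ψ (p.1, x))
      ((fderiv ℝ ψ p) ∘L (ContinuousLinearMap.inr ℝ ℝ E3)) p.2 := by
    have h : HasFDerivAt ψ (fderiv ℝ ψ p) (p.1, p.2) := hψ.hasFDerivAt
    exact h.comp p.2 (hasFDerivAt_prodMk_right p.1 p.2)
  have h2 : inner ℝ (gradient (fun x : E3 => ψ (p.1, x)) p.2) (EuclideanSpace.single i 1)
      = partialDeriv i.succ ψ p := by
    rw [gradient, InnerProductSpace.toDual_symm_apply, h1.fderiv]
    rfl
  rw [← h2, EuclideanSpace.inner_single_right]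
  simp

/-- Pythagoras: the spatial gradient splits into its radial part, of length |∂_r ψ|, and its
projection to x^⊥. -/
theorem norm_angularGradient_sq (hψ : DifferentiableAt ℝ ψ p) (hp : 0 < radius p) :
    ‖angularGradient ψ p‖ ^ 2
      = ∑ i : Fin 3, partialDeriv i.succ ψ p ^ 2 - radialDeriv ψ p ^ 2 := by
  set v := gradient (fun x : E3 => ψ (p.1, x)) p.2 with hv
  have h1 : ‖v‖ ^ 2 = ∑ i : Fin 3, partialDeriv i.succ ψ p ^ 2 := by
    rw [EuclideanSpace.real_norm_sq_eq]
    simp only [hv, gradient_slice_apply hψ]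
  have h2 : inner ℝ p.2 v = radius p * radialDeriv ψ p := by
    rw [PiLp.inner_apply]
    simp only [hv, gradient_slice_apply hψ, radialDeriv, unitRadial, Finset.mul_sum]
    refine Finset.sum_congr rfl fun i _ => ?_
    simp
    field_simp
  have h3 := Submodule.norm_sq_eq_add_norm_sq_starProjection v (ℝ ∙ p.2)
  have h4 : ‖(ℝ ∙ p.2).starProjection v‖ ^ 2 = radialDeriv ψ p ^ 2 := by
    rw [Submodule.starProjection_singleton, h2, norm_smul, mul_pow, Real.norm_eq_abs, sq_abs]
    change _ * radius p ^ 2 = _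
    have : (((‖p.2‖ ^ 2 : ℝ) : ℝ)) = radius p ^ 2 := rfl
    simp only [RCLike.ofReal_real_eq_id, id, this]
    field_simp
  rw [angularGradient, ← hv]
  linarith

theorem energyDensity_eq (hψ : DifferentiableAt ℝ ψ p) (hp : 0 < radius p)
    (hF : 0 < warp Λ m (radius p)) :
    energyDensity Λ m ψ p = warp Λ m (radius p) * radialDeriv ψ p ^ 2
      + (warp Λ m (radius p))⁻¹ * partialDeriv 0 ψ p ^ 2
      + (∑ i : Fin 3, partialDeriv i.succ ψ p ^ 2 - radialDeriv ψ p ^ 2) := by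
  rw [energyDensity, lapse_sq hF, fderiv_vecR, fderiv_vecT, norm_angularGradient_sq hψ hp]
  simp

theorem le_energyDensity (hF : 0 < warp Λ m (radius p)) :
    warp Λ m (radius p) * radialDeriv ψ p ^ 2
      + (warp Λ m (radius p))⁻¹ * partialDeriv 0 ψ p ^ 2 ≤ energyDensity Λ m ψ p := by
  rw [energyDensity, lapse_sq hF, fderiv_vecR, fderiv_vecT]
  simp

/-- The weights F and 1/F have product 1, so the arithmetic-geometric mean inequality applies; in
`h1` the choices s = ±1 complete the square. This gives |J^t| ≤ e/(2F), the bound behind the finite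
speed 1/F. -/
theorem abs_mul_le_energyDensity (hF : 0 < warp Λ m (radius p)) :
    2 * |radialDeriv ψ p * partialDeriv 0 ψ p| ≤ energyDensity Λ m ψ p := by
  refine le_trans ?_ (le_energyDensity hF)
  have h := mul_inv_cancel₀ hF.ne'
  have hG := inv_pos.2 hF
  generalize (warp Λ m (radius p))⁻¹ = G at *
  generalize warp Λ m (radius p) = F at *
  have h1 : ∀ s : ℝ, F * radialDeriv ψ p ^ 2 + G * partialDeriv 0 ψ p ^ 2
      + 2 * s * (radialDeriv ψ p * partialDeriv 0 ψ p)
      = G * (F * radialDeriv ψ p + s * partialDeriv 0 ψ p) ^ 2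
        + G * (1 - s ^ 2) * partialDeriv 0 ψ p ^ 2 := by
    intro s
    linear_combination -(F * radialDeriv ψ p ^ 2
      + 2 * s * (radialDeriv ψ p * partialDeriv 0 ψ p)) * h
  have h2 := h1 1
  have h3 := h1 (-1)
  have h4 : 0 ≤ G * (F * radialDeriv ψ p + 1 * partialDeriv 0 ψ p) ^ 2 := by positivity
  have h5 : 0 ≤ G * (F * radialDeriv ψ p + -1 * partialDeriv 0 ψ p) ^ 2 := by positivity
  rcases abs_cases (radialDeriv ψ p * partialDeriv 0 ψ p) with h | h <;> rw [h.1] <;> nlinarith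

theorem energyDensity_nonneg (hF : 0 < warp Λ m (radius p)) : 0 ≤ energyDensity Λ m ψ p :=
  (by positivity : (0 : ℝ) ≤ 2 * |radialDeriv ψ p * partialDeriv 0 ψ p|).trans
    (abs_mul_le_energyDensity hF)

theorem current_zero_eq : current Λ m ψ 0 p
    = (warp Λ m (radius p))⁻¹ * (radialDeriv ψ p * partialDeriv 0 ψ p) := by
  simp only [current, flux, Fin.cons_zero]
  ring

theorem sum_unitRadial_mul_current (hψ : DifferentiableAt ℝ ψ p) (hp : 0 < radius p)
    (hF : 0 < warp Λ m (radius p)) :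
    ∑ i : Fin 3, unitRadial i p * current Λ m ψ i.succ p = -(1 / 2) * energyDensity Λ m ψ p := by
  have hs := sum_unitRadial_sq hp
  rw [energyDensity_eq hψ hp hF]
  simp only [current, flux, Fin.cons_succ, lagrangian]
  have ha : radialDeriv ψ p = ∑ i : Fin 3, unitRadial i p * partialDeriv i.succ ψ p := rfl
  generalize radialDeriv ψ p = a at *
  simp only [Fin.sum_univ_three] at *
  generalize (warp Λ m (radius p))⁻¹ = G at *
  generalize warp Λ m (radius p) = F at *
  linear_combination -a * ha + (-(1 + F) * a ^ 2 - 1 / 2 * (G * partialDeriv 0 ψ p ^ 2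
      + (partialDeriv (Fin.succ 0) ψ p ^ 2 + partialDeriv (Fin.succ 1) ψ p ^ 2
        + partialDeriv (Fin.succ 2) ψ p ^ 2) - (1 + F) * a ^ 2)) * hs

/-- A weight depending on t and r alone has a spatial gradient along n, so its derivatives meet only
the t-component and the radial component -e/2 of the current. -/
theorem sum_partialDeriv_mul_current {w : Spacetime → ℝ} {wt wr : ℝ} (hψ : ContDiffAt ℝ 2 ψ p)
    (hp : 0 < radius p) (hF : 0 < warp Λ m (radius p)) (hw : DifferentiableAt ℝ w p)
    (hwt : partialDeriv 0 w p = wt)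
    (hwr : ∀ i : Fin 3, partialDeriv i.succ w p = wr * unitRadial i p) :
    ∑ μ, partialDeriv μ (fun q => w q * current Λ m ψ μ q) p
      = w p * ∑ μ, partialDeriv μ (current Λ m ψ μ) p
        + wt * ((warp Λ m (radius p))⁻¹ * (radialDeriv ψ p * partialDeriv 0 ψ p))
        - 1 / 2 * wr * energyDensity Λ m ψ p := by
  have hJ : ∀ μ, DifferentiableAt ℝ (current Λ m ψ μ) p := fun μ =>
    (contDiffAt_current hψ hp hF μ).differentiableAt one_ne_zero
  have hs := sum_unitRadial_mul_current (hψ.differentiableAt two_ne_zero) hp hF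
  simp only [fun μ => partialDeriv_mul μ hw (hJ μ), Finset.sum_add_distrib, ← Finset.mul_sum]
  rw [Fin.sum_univ_succ (n := 3) (f := fun μ => current Λ m ψ μ p * partialDeriv μ w p), hwt,
    current_zero_eq]
  have : ∑ i : Fin 3, current Λ m ψ i.succ p * partialDeriv i.succ w p
      = wr * ∑ i : Fin 3, unitRadial i p * current Λ m ψ i.succ p := by
    rw [Finset.mul_sum]
    refine Finset.sum_congr rfl fun i _ => ?_
    rw [hwr]
    ring
  rw [this, hs]
  ring

theorem sum_partialDeriv_current_nonneg (hΛ : 0 < Λ) (hm : 0 < m) (hsub : 3 * m * √Λ < 1)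
    (hψ : IsWaveSolution Λ m ψ) (hp : p ∈ expandingRegion Λ m) :
    0 ≤ ∑ μ, partialDeriv μ (current Λ m ψ μ) p := by
  have hF := warp_pos hΛ hm hsub hp
  have hr : 0 < radius p := (cosmologicalRadius_pos hΛ hm hsub).trans hp
  have hF' := warpDeriv_pos hΛ hm hsub hp
  have hC : ContDiffAt ℝ 2 ψ p :=
    hψ.contDiffOn.contDiffAt ((isOpen_expandingRegion Λ m).mem_nhds hp)
  rw [sum_partialDeriv_current hC hr hF (sum_partialDeriv_flux hΛ hm hsub hψ hp)]
  have h2 : 0 ≤ radius p * warpDeriv Λ m (radius p) - 2 * warp Λ m (radius p) :=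
    sub_nonneg.2 (two_mul_warp_le hΛ hm hsub hp)
  positivity

end

/-! ### Localization in t to a shrinking cone. -/

/-- A smooth cutoff in `t` whose support `|t| ≤ R - C r` shrinks with speed `C` as `r` grows. -/
def coneCutoff (C R : ℝ) (q : Spacetime) : ℝ :=
  Real.smoothTransition (R - q.1 - C * radius q) * Real.smoothTransition (R + q.1 - C * radius q)

theorem coneCutoff_nonneg (C R : ℝ) (q : Spacetime) : 0 ≤ coneCutoff C R q :=
  mul_nonneg (Real.smoothTransition.nonneg _) (Real.smoothTransition.nonneg _)

theorem coneCutoff_le_one (C R : ℝ) (q : Spacetime) : coneCutoff C R q ≤ 1 :=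
  mul_le_one₀ (Real.smoothTransition.le_one _) (Real.smoothTransition.nonneg _)
    (Real.smoothTransition.le_one _)

theorem coneCutoff_eq_zero {C R : ℝ} (hC : 0 ≤ C) {q : Spacetime} (h : R < |q.1|) :
    coneCutoff C R q = 0 := by
  have hr : 0 ≤ C * radius q := mul_nonneg hC (norm_nonneg _)
  rw [coneCutoff]
  rcases abs_cases q.1 with h' | h'
  · rw [Real.smoothTransition.zero_of_nonpos (by linarith), zero_mul]
  · rw [Real.smoothTransition.zero_of_nonpos (x := R + q.1 - C * radius q) (by linarith), mul_zero]

theorem coneCutoff_eq_one {C R : ℝ} {q : Spacetime} (h : |q.1| + C * radius q + 1 ≤ R) :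
    coneCutoff C R q = 1 := by
  rw [coneCutoff, Real.smoothTransition.one_of_one_le, Real.smoothTransition.one_of_one_le, one_mul]
  · linarith [neg_abs_le q.1]
  · linarith [le_abs_self q.1]

theorem continuous_coneCutoff (C R : ℝ) : Continuous (coneCutoff C R) := by
  have h : Continuous radius := continuous_norm.comp continuous_snd
  have hS := Real.smoothTransition.continuous
  unfold coneCutoff
  fun_prop

theorem contDiffAt_coneCutoff (C R : ℝ) {q : Spacetime} (hq : 0 < radius q) :
    ContDiffAt ℝ 1 (coneCutoff C R) q := by
  have h := contDiffAt_radius hq (n := 1)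
  have hS : ContDiff ℝ 1 Real.smoothTransition := Real.smoothTransition.contDiff
  unfold coneCutoff
  exact (hS.contDiffAt.comp q ((contDiffAt_const.sub contDiffAt_fst).sub
    (contDiffAt_const.mul h))).mul (hS.contDiffAt.comp q
      ((contDiffAt_const.add contDiffAt_fst).sub (contDiffAt_const.mul h)))

/-- X and Y are the contributions of the right and left edges of the cone. They enter ∂_t with
opposite signs, but ∂_r with the same sign and the factor C, so |∂_t χ| ≤ -C⁻¹ ∂_r χ when C > 0. -/
theorem partialDeriv_coneCutoff (C R : ℝ) {q : Spacetime} (hq : 0 < radius q) :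
    ∃ X Y : ℝ, 0 ≤ X ∧ 0 ≤ Y ∧ partialDeriv 0 (coneCutoff C R) q = Y - X ∧
      ∀ i : Fin 3, partialDeriv i.succ (coneCutoff C R) q = -(C * (X + Y)) * unitRadial i q := by
  have hr := (contDiffAt_radius hq (n := 1)).differentiableAt one_ne_zero
  have hS : ∀ x, HasDerivAt Real.smoothTransition (deriv Real.smoothTransition x) x := fun x =>
    ((Real.smoothTransition.contDiff (n := 1)).differentiable one_ne_zero x).hasDerivAt
  have hS' : ∀ x, 0 ≤ deriv Real.smoothTransition x := fun x =>
    Real.smoothTransition.monotone.deriv_nonneg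
  have ht : DifferentiableAt ℝ (fun q : Spacetime => q.1) q := differentiableAt_fst
  have hu : DifferentiableAt ℝ (fun q : Spacetime => R - q.1 - C * radius q) q := by fun_prop
  have hv : DifferentiableAt ℝ (fun q : Spacetime => R + q.1 - C * radius q) q := by fun_prop
  have ht0 : partialDeriv 0 (fun q : Spacetime => q.1) q = 1 := by
    simp [partialDeriv, fderiv_fst, frame_zero]
  have hti : ∀ i : Fin 3, partialDeriv i.succ (fun q : Spacetime => q.1) q = 0 := by
    intro i
    simp [partialDeriv, fderiv_fst, frame_succ]
  have hdu : ∀ μ, partialDeriv μ (fun q : Spacetime => R - q.1 - C * radius q) q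
      = -partialDeriv μ (fun q : Spacetime => q.1) q - C * partialDeriv μ radius q := by
    intro μ
    rw [partialDeriv_sub μ (ht.const_sub R) (hr.const_mul C), partialDeriv_const_mul μ C hr]
    simp [partialDeriv, fderiv_const_sub]
  have hdv : ∀ μ, partialDeriv μ (fun q : Spacetime => R + q.1 - C * radius q) q
      = partialDeriv μ (fun q : Spacetime => q.1) q - C * partialDeriv μ radius q := by
    intro μ
    rw [partialDeriv_sub μ (ht.const_add R) (hr.const_mul C), partialDeriv_const_mul μ C hr,
      partialDeriv_const_add]
  have key : ∀ μ, partialDeriv μ (coneCutoff C R) q = _ := fun μ =>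
    partialDeriv_mul μ (f := fun q => Real.smoothTransition (R - q.1 - C * radius q))
      (g := fun q => Real.smoothTransition (R + q.1 - C * radius q))
      ((hS _).differentiableAt.comp q hu) ((hS _).differentiableAt.comp q hv)
  simp only [fun μ => partialDeriv_comp μ (hS _) hu, fun μ => partialDeriv_comp μ (hS _) hv,
    hdu, hdv] at key
  refine ⟨deriv Real.smoothTransition (R - q.1 - C * radius q)
      * Real.smoothTransition (R + q.1 - C * radius q),
    Real.smoothTransition (R - q.1 - C * radius q)
      * deriv Real.smoothTransition (R + q.1 - C * radius q),
    mul_nonneg (hS' _) (Real.smoothTransition.nonneg _),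
    mul_nonneg (Real.smoothTransition.nonneg _) (hS' _), ?_, fun i => ?_⟩
  · rw [key, ht0, partialDeriv_zero_radius hq]
    ring
  · rw [key, hti, partialDeriv_succ_radius hq]
    ring

/-- The divergence of the energy current, localized in `t` to a shrinking cone and in `r` by a
cutoff `ζ`, is bounded below by the term in which the derivative falls on `ζ`. -/
theorem neg_le_sum_partialDeriv_cutoff {Λ m : ℝ} {ψ : Spacetime → ℝ} {p : Spacetime}
    (hΛ : 0 < Λ) (hm : 0 < m) (hsub : 3 * m * √Λ < 1)
    (hψ : IsWaveSolution Λ m ψ) (hp : p ∈ expandingRegion Λ m) {ζ : ℝ → ℝ}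
    (hζ : DifferentiableAt ℝ ζ (radius p)) (hζ0 : 0 ≤ ζ (radius p)) {C : ℝ} (R : ℝ)
    (hC : ζ (radius p) ≠ 0 → (warp Λ m (radius p))⁻¹ ≤ C) :
    -(1 / 2 * (deriv ζ (radius p) * (coneCutoff C R p * energyDensity Λ m ψ p)))
      ≤ ∑ μ, partialDeriv μ
        (fun q => ζ (radius q) * coneCutoff C R q * current Λ m ψ μ q) p := by
  have hF := warp_pos hΛ hm hsub hp
  have hr : 0 < radius p := (cosmologicalRadius_pos hΛ hm hsub).trans hp
  have hψ2 : ContDiffAt ℝ 2 ψ p :=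
    hψ.contDiffOn.contDiffAt ((isOpen_expandingRegion Λ m).mem_nhds hp)
  obtain ⟨X, Y, hX, hY, h0, hi⟩ := partialDeriv_coneCutoff C R hr
  have hrd := (contDiffAt_radius hr (n := 1)).differentiableAt one_ne_zero
  have hζd : DifferentiableAt ℝ (fun q => ζ (radius q)) p := hζ.comp p hrd
  have hcd := (contDiffAt_coneCutoff C R hr).differentiableAt one_ne_zero
  have hwd := hζd.fun_mul hcd
  have hdw : ∀ μ, partialDeriv μ (fun q => ζ (radius q) * coneCutoff C R q) p = _ := fun μ =>
    partialDeriv_mul μ hζd hcd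
  simp only [fun μ => partialDeriv_comp μ hζ.hasDerivAt hrd] at hdw
  rw [sum_partialDeriv_mul_current (wt := ζ (radius p) * (Y - X))
    (wr := deriv ζ (radius p) * coneCutoff C R p - ζ (radius p) * (C * (X + Y)))
    hψ2 hr hF hwd]
  · have hdiv := sum_partialDeriv_current_nonneg hΛ hm hsub hψ hp
    have hχ := coneCutoff_nonneg C R p
    have h1 : 0 ≤ ζ (radius p) * coneCutoff C R p
        * ∑ μ, partialDeriv μ (current Λ m ψ μ) p := by positivity
    -- The terms with derivatives of the cone cutoff. Grouped by X and Y they are X (Ce/2 - J^t) + Y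
    -- (Ce/2 + J^t), and |J^t| ≤ e/(2F) ≤ Ce/2 wherever ζ is nonzero.
    have h2 : 0 ≤ ζ (radius p) * ((Y - X) * ((warp Λ m (radius p))⁻¹
        * (radialDeriv ψ p * partialDeriv 0 ψ p))
        + 1 / 2 * (C * (X + Y)) * energyDensity Λ m ψ p) := by
      rcases eq_or_ne (ζ (radius p)) 0 with h | h
      · rw [h, zero_mul]
      · refine mul_nonneg hζ0 ?_
        have hG := inv_pos.2 hF
        have hCG := hC h
        have he := abs_mul_le_energyDensity (ψ := ψ) hF
        have he0 := energyDensity_nonneg (ψ := ψ) hF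
        have hCe : (warp Λ m (radius p))⁻¹ * energyDensity Λ m ψ p
            ≤ C * energyDensity Λ m ψ p := by gcongr
        have hb : (warp Λ m (radius p))⁻¹ * (2 * |radialDeriv ψ p * partialDeriv 0 ψ p|)
            ≤ (warp Λ m (radius p))⁻¹ * energyDensity Λ m ψ p := by gcongr
        have hb1 : (warp Λ m (radius p))⁻¹ * (radialDeriv ψ p * partialDeriv 0 ψ p)
            ≤ (warp Λ m (radius p))⁻¹ * |radialDeriv ψ p * partialDeriv 0 ψ p| := by
          gcongr; exact le_abs_self _
        have hb2 : (warp Λ m (radius p))⁻¹ * -(radialDeriv ψ p * partialDeriv 0 ψ p)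
            ≤ (warp Λ m (radius p))⁻¹ * |radialDeriv ψ p * partialDeriv 0 ψ p| := by
          gcongr; exact neg_le_abs _
        have e1 : 0 ≤ X * (1 / 2 * (C * energyDensity Λ m ψ p)
          - (warp Λ m (radius p))⁻¹ * (radialDeriv ψ p * partialDeriv 0 ψ p)) :=
          mul_nonneg hX (by linarith)
        have e2 : 0 ≤ Y * (1 / 2 * (C * energyDensity Λ m ψ p)
          + (warp Λ m (radius p))⁻¹ * (radialDeriv ψ p * partialDeriv 0 ψ p)) :=
          mul_nonneg hY (by linarith)
        linarith
    linarith
  · rw [hdw, h0, partialDeriv_zero_radius hr]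
    ring
  · intro i
    rw [hdw, hi, partialDeriv_succ_radius hr]
    ring

/-! ### Polar coordinates and integration over spacetime. -/

/-- The unit sphere. -/
abbrev S2 : Type := Metric.sphere (0 : E3) 1

/-- The measure `dt dσ` on the cylinder `ℝ × S²`. -/
def cylinderMeasure : Measure (ℝ × S2) :=
  (volume : Measure ℝ).prod (volume : Measure E3).toSphere

instance : SFinite cylinderMeasure := by
  unfold cylinderMeasure
  infer_instance

instance : IsFiniteMeasureOnCompacts cylinderMeasure := by
  unfold cylinderMeasure
  infer_instance

/-- Polar coordinates on the punctured space, with radial density r² for dimension 3; the origin is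
a null set. -/
theorem measurePreserving_polar :
    MeasurePreserving (fun y : S2 × Set.Ioi (0 : ℝ) => (y.2 : ℝ) • (y.1 : E3))
      ((volume : Measure E3).toSphere.prod (Measure.volumeIoiPow 2)) volume := by
  have h1 := (volume : Measure E3).measurePreserving_homeomorphUnitSphereProd
  have hd : Module.finrank ℝ E3 - 1 = 2 := by simp
  rw [hd] at h1
  have h2 := MeasurePreserving.symm (homeomorphUnitSphereProd E3).toMeasurableEquiv h1
  have h3 := measurePreserving_subtype_coe (μa := (volume : Measure E3))
    (measurableSet_singleton (0 : E3)).compl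
  rw [restrict_compl_singleton] at h3
  exact h3.comp h2

theorem measurePreserving_cylinder :
    MeasurePreserving (fun z : (ℝ × S2) × Set.Ioi (0 : ℝ) =>
        ((z.1.1, (z.2 : ℝ) • (z.1.2 : E3)) : Spacetime))
      (cylinderMeasure.prod (Measure.volumeIoiPow 2)) volume :=
  ((MeasurePreserving.id (volume : Measure ℝ)).prod measurePreserving_polar).comp
    (measurePreserving_prodAssoc volume (volume : Measure E3).toSphere (Measure.volumeIoiPow 2))

theorem radius_slice {r : ℝ} (hr : 0 ≤ r) (z : ℝ × S2) : radius (z.1, r • (z.2 : E3)) = r := by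
  simp [radius, norm_smul, abs_of_nonneg hr]

/-- Fubini for the foliation by the level sets of the radius. -/
theorem integral_eq_integral_slices {f : Spacetime → ℝ} (hf : Integrable f) :
    ∫ q, f q = ∫ r in Set.Ioi (0 : ℝ), r ^ 2 * ∫ z, f (z.1, r • (z.2 : E3)) ∂cylinderMeasure := by
  have hmp := measurePreserving_cylinder
  rw [← hmp.map_eq, integral_map hmp.measurable.aemeasurable
    (by rw [hmp.map_eq]; exact hf.aestronglyMeasurable), integral_prod_symm]
  · rw [Measure.volumeIoiPow]
    simp only [ENNReal.ofReal]
    rw [integral_withDensity_eq_integral_smul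
      (measurable_subtype_coe.pow_const _).real_toNNReal,
      integral_subtype_comap measurableSet_Ioi fun r : ℝ => Real.toNNReal (r ^ 2) •
        ∫ z, f (z.1, r • (z.2 : E3)) ∂cylinderMeasure]
    refine setIntegral_congr_fun measurableSet_Ioi fun r _ => ?_
    simp only [NNReal.smul_def, Real.coe_toNNReal _ (sq_nonneg r), smul_eq_mul]
  · exact (hmp.integrable_comp hf.aestronglyMeasurable).2 hf

theorem integral_partialDeriv_eq_zero {f : Spacetime → ℝ} (hf : ContDiff ℝ 1 f)
    (hc : HasCompactSupport f) (μ : Fin 4) : Integrable (partialDeriv μ f) ∧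
      ∫ q, partialDeriv μ f q = 0 := by
  have hi : Integrable (partialDeriv μ f) :=
    ((hf.continuous_fderiv one_ne_zero).clm_apply continuous_const).integrable_of_hasCompactSupport
      (hc.fderiv_apply ℝ (frame μ))
  refine ⟨hi, ?_⟩
  have : (volume : Measure Spacetime).IsAddHaarMeasure :=
    Measure.prod.instIsAddHaarMeasure volume volume
  -- Integration by parts against the constant 1.
  have h := integral_mul_fderiv_eq_neg_fderiv_mul_of_integrable (μ := (volume : Measure Spacetime))
    (f := fun _ => (1 : ℝ)) (g := f) (v := frame μ) (by simp)
    (by simp only [one_mul]; exact hi) (by simpa using hf.continuous.integrable_of_hasCompactSupport hc)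
    (fun _ _ => differentiableAt_const _) (fun x _ => hf.differentiable one_ne_zero x)
  simpa [partialDeriv] using h

theorem isCompact_shell (R a b : ℝ) :
    IsCompact {q : Spacetime | |q.1| ≤ R ∧ a ≤ radius q ∧ radius q ≤ b} := by
  have hr : Continuous radius := continuous_norm.comp continuous_snd
  refine ((isCompact_Icc (a := -R) (b := R)).prod
    (isCompact_closedBall (0 : E3) b)).of_isClosed_subset ?_ ?_
  · exact (isClosed_le (continuous_abs.comp continuous_fst) continuous_const).inter
      ((isClosed_le continuous_const hr).inter (isClosed_le hr continuous_const))
  · rintro q ⟨h1, -, h2⟩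
    exact ⟨abs_le.1 h1, by simpa [radius] using h2⟩

/-! ### Monotonicity of the localized energy in the sense of distributions. -/

section Localization

variable {Λ m : ℝ} {ψ : Spacetime → ℝ}

theorem continuousOn_energyDensity (hΛ : 0 < Λ) (hm : 0 < m) (hsub : 3 * m * √Λ < 1)
    (hψ : IsWaveSolution Λ m ψ) :
    ContinuousOn (energyDensity Λ m ψ) (expandingRegion Λ m) := by
  have hpos : ∀ q ∈ expandingRegion Λ m, 0 < radius q := fun q hq =>
    (cosmologicalRadius_pos hΛ hm hsub).trans hq
  have hC : ∀ q ∈ expandingRegion Λ m, ContDiffAt ℝ 2 ψ q := fun q hq =>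
    hψ.contDiffOn.contDiffAt ((isOpen_expandingRegion Λ m).mem_nhds hq)
  refine ContinuousOn.congr (f := fun p => warp Λ m (radius p) * radialDeriv ψ p ^ 2
      + (warp Λ m (radius p))⁻¹ * partialDeriv 0 ψ p ^ 2
      + (∑ i : Fin 3, partialDeriv i.succ ψ p ^ 2 - radialDeriv ψ p ^ 2)) ?_ fun q hq =>
    energyDensity_eq ((hC q hq).differentiableAt two_ne_zero) (hpos q hq)
      (warp_pos hΛ hm hsub hq)
  intro q hq
  refine ContinuousAt.continuousWithinAt ?_
  have hw : ContinuousAt (fun p => warp Λ m (radius p)) q :=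
    (contDiffAt_warp (hpos q hq) (n := 1)).continuousAt
  have ha := (contDiffAt_radialDeriv (hC q hq) (hpos q hq)).continuousAt
  have hd := fun μ => (contDiffAt_partialDeriv (hC q hq) μ).continuousAt
  have hs : ContinuousAt (fun p => ∑ i : Fin 3, partialDeriv i.succ ψ p ^ 2) q :=
    tendsto_finsetSum _ fun i _ => (hd i.succ).pow 2
  exact ((hw.mul (ha.pow 2)).add ((hw.inv₀ (warp_pos hΛ hm hsub hq).ne').mul ((hd 0).pow 2))).add
    (hs.sub (ha.pow 2))

/-- The energy of a solution, localized to a shrinking cone, is nonincreasing in the sense of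
distributions in the variable `r`. -/
theorem integral_deriv_mul_energyDensity_nonneg (hΛ : 0 < Λ) (hm : 0 < m)
    (hsub : 3 * m * √Λ < 1) (hψ : IsWaveSolution Λ m ψ) {a b : ℝ}
    (ha : cosmologicalRadius Λ m < a) {ζ : ℝ → ℝ} (hζ : ContDiff ℝ 1 ζ) (hζ0 : ∀ r, 0 ≤ ζ r)
    (hζs : ∀ r, ζ r ≠ 0 → a ≤ r ∧ r ≤ b) (R : ℝ) :
    Integrable (fun q => deriv ζ (radius q)
        * (coneCutoff (warp Λ m a)⁻¹ R q * energyDensity Λ m ψ q)) ∧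
    0 ≤ ∫ q, deriv ζ (radius q)
      * (coneCutoff (warp Λ m a)⁻¹ R q * energyDensity Λ m ψ q) := by
  set C := (warp Λ m a)⁻¹ with hCdef
  have hC0 : 0 ≤ C := (inv_pos.2 (warp_pos hΛ hm hsub ha)).le
  set K := {q : Spacetime | |q.1| ≤ R ∧ a ≤ radius q ∧ radius q ≤ b} with hK
  have hKc : IsCompact K := isCompact_shell R a b
  have hKU : K ⊆ expandingRegion Λ m := fun q hq => ha.trans_le hq.2.1
  have hpos : ∀ q ∈ expandingRegion Λ m, 0 < radius q := fun q hq =>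
    (cosmologicalRadius_pos hΛ hm hsub).trans hq
  have hψ2 : ∀ q ∈ expandingRegion Λ m, ContDiffAt ℝ 2 ψ q := fun q hq =>
    hψ.contDiffOn.contDiffAt ((isOpen_expandingRegion Λ m).mem_nhds hq)
  have hζ' : ∀ r, deriv ζ r ≠ 0 → a ≤ r ∧ r ≤ b := by
    intro r hr
    have h1 : r ∈ tsupport ζ := support_deriv_subset hr
    exact closure_minimal (fun r hr => hζs r hr) isClosed_Icc h1
  have hχ : ∀ q, coneCutoff C R q ≠ 0 → |q.1| ≤ R := fun q hq => by
    by_contra! h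
    exact hq (coneCutoff_eq_zero hC0 h)
  set W : Fin 4 → Spacetime → ℝ := fun μ q =>
    ζ (radius q) * coneCutoff C R q * current Λ m ψ μ q with hW
  have hWK : ∀ μ, tsupport (W μ) ⊆ K := fun μ => closure_minimal (fun q hq => by
    have h1 := left_ne_zero_of_mul hq
    exact ⟨hχ q (right_ne_zero_of_mul h1), hζs _ (left_ne_zero_of_mul h1)⟩) hKc.isClosed
  have hWc : ∀ μ, HasCompactSupport (W μ) := fun μ =>
    hKc.of_isClosed_subset (isClosed_tsupport _) (hWK μ)
  -- Nothing is known about ψ outside the expanding region; global regularity holds because `W μ` is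
  -- supported in the compact shell `K` inside it.
  have hWd : ∀ μ, ContDiff ℝ 1 (W μ) := fun μ => contDiff_iff_contDiffAt.2 fun q => by
    by_cases hq : q ∈ tsupport (W μ)
    swap
    · exact contDiffAt_const.congr_of_eventuallyEq (notMem_tsupport_iff_eventuallyEq.1 hq)
    have hq := hKU (hWK μ hq)
    exact ((hζ.contDiffAt.comp q (contDiffAt_radius (hpos q hq))).mul
      (contDiffAt_coneCutoff C R (hpos q hq))).mul
        (contDiffAt_current (hψ2 q hq) (hpos q hq) (warp_pos hΛ hm hsub hq) μ)
  set f : Spacetime → ℝ := fun q => deriv ζ (radius q)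
      * (coneCutoff C R q * energyDensity Λ m ψ q) with hf
  have hfK : tsupport f ⊆ K := closure_minimal (fun q hq => by
    have h1 := right_ne_zero_of_mul hq
    exact ⟨hχ q (left_ne_zero_of_mul h1), hζ' _ (left_ne_zero_of_mul hq)⟩) hKc.isClosed
  have hrc : Continuous radius := continuous_norm.comp continuous_snd
  have hfc : Continuous f := continuous_of_tsupport fun q hq => by
    have hq := (isOpen_expandingRegion Λ m).mem_nhds (hKU (hfK hq))
    exact ((hζ.continuous_deriv le_rfl).comp hrc).continuousAt.mul
      ((continuous_coneCutoff C R).continuousAt.mul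
        ((continuousOn_energyDensity hΛ hm hsub hψ).continuousAt hq))
  have hfi : Integrable f := hfc.integrable_of_hasCompactSupport
    (hKc.of_isClosed_subset (isClosed_tsupport _) hfK)
  refine ⟨hfi, ?_⟩
  have hsum : ∫ q, ∑ μ, partialDeriv μ (W μ) q = 0 := by
    rw [integral_finsetSum _ fun μ _ => (integral_partialDeriv_eq_zero (hWd μ) (hWc μ) μ).1]
    exact Finset.sum_eq_zero fun μ _ => (integral_partialDeriv_eq_zero (hWd μ) (hWc μ) μ).2
  have hle : ∫ q, -(1 / 2 * f q) ≤ ∫ q, ∑ μ, partialDeriv μ (W μ) q := by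
    refine integral_mono (hfi.const_mul _).neg (integrable_finsetSum _ fun μ _ =>
      (integral_partialDeriv_eq_zero (hWd μ) (hWc μ) μ).1) fun q => ?_
    by_cases hq : q ∈ expandingRegion Λ m
    · refine neg_le_sum_partialDeriv_cutoff hΛ hm hsub hψ hq
        (hζ.differentiable one_ne_zero _) (hζ0 _) R fun h => ?_
      have har := (hζs _ h).1
      -- F is increasing, so 1/F(a) bounds the light speed 1/F(r) for all r ≥ a.
      exact inv_anti₀ (warp_pos hΛ hm hsub ha)
        ((warp_strictMonoOn hΛ hm hsub).monotoneOn ha.le (Set.mem_Ici.2 (le_of_lt hq)) har)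
    · have h1 : f q = 0 := image_eq_zero_of_notMem_tsupport fun h => hq (hKU (hfK h))
      have h2 : ∀ μ, partialDeriv μ (W μ) q = 0 := fun μ => by
        have h3 : W μ =ᶠ[nhds q] 0 := notMem_tsupport_iff_eventuallyEq.1
          fun h => hq (hKU (hWK μ h))
        simp [partialDeriv, h3.fderiv_eq]
      simp [h1, h2]
  rw [hsum, integral_neg, integral_const_mul] at hle
  linarith

end Localization

/-! ### From distributional to pointwise monotonicity. -/

/-- A continuous function that is nonincreasing in the sense of distributions on `[r₁, ∞)` is
nonincreasing there. -/
theorem le_of_forall_integral_deriv_mul_nonneg {G : ℝ → ℝ} {r₁ r₂ : ℝ} (h₀ : 0 < r₁)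
    (h : r₁ < r₂) (hG₁ : ContinuousAt G r₁) (hG₂ : ContinuousAt G r₂)
    (hG : ∀ (ζ : ℝ → ℝ) (b : ℝ), ContDiff ℝ 1 ζ → (∀ r, 0 ≤ ζ r) →
      (∀ r, ζ r ≠ 0 → r₁ ≤ r ∧ r ≤ b) →
      IntegrableOn (fun r => deriv ζ r * G r) (Set.Ioi 0) ∧
      0 ≤ ∫ r in Set.Ioi 0, deriv ζ r * G r) : G r₂ ≤ G r₁ := by
  by_contra! hlt
  obtain ⟨A, hA1, hA⟩ := exists_between hlt
  obtain ⟨B, hB1, hB⟩ := exists_between hA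
  obtain ⟨ε₁, hε₁, h1⟩ := Metric.eventually_nhds_iff.1 (hG₁.eventually_lt_const hA1)
  obtain ⟨ε₂, hε₂, h2⟩ := Metric.eventually_nhds_iff.1 (hG₂.eventually_const_lt hB)
  obtain ⟨ε, hε, hεlt⟩ := exists_between (lt_min hε₁ hε₂)
  have hε1 : ε < ε₁ := hεlt.trans_le (min_le_left _ _)
  have hε2 : ε < ε₂ := hεlt.trans_le (min_le_right _ _)
  -- A smooth step rising from 0 at c to 1 at c + ε. Its derivative is a nonnegative bump of mass 1,
  -- on whose support G stays below A when c = r₁ and above B when c = r₂.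
  let S : ℝ → ℝ → ℝ := fun c r => Real.smoothTransition ((r - c) / ε)
  have hS : ∀ c, ContDiff ℝ 1 (S c) := fun c =>
    (Real.smoothTransition.contDiff (n := 1)).comp ((contDiff_id.sub contDiff_const).div_const ε)
  have hSm : ∀ c, Monotone (S c) := fun c x y hxy =>
    Real.smoothTransition.monotone (by gcongr)
  have hS0 : ∀ c r, r ≤ c → S c r = 0 := fun c r hr =>
    Real.smoothTransition.zero_of_nonpos (div_nonpos_of_nonpos_of_nonneg (by linarith) hε.le)
  have hS1 : ∀ c r, c + ε ≤ r → S c r = 1 := fun c r hr =>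
    Real.smoothTransition.one_of_one_le (by rw [le_div_iff₀ hε]; linarith)
  have hSd : ∀ c r, HasDerivAt (S c) (deriv (S c) r) r := fun c r =>
    ((hS c).differentiable one_ne_zero r).hasDerivAt
  have hSd0 : ∀ c r, 0 ≤ deriv (S c) r := fun c r => (hSm c).deriv_nonneg
  have hSs : ∀ c r, deriv (S c) r ≠ 0 → c ≤ r ∧ r ≤ c + ε := by
    intro c r hr
    constructor
    · by_contra! hlt
      refine hr ?_
      have : S c =ᶠ[nhds r] fun _ => 0 := by
        filter_upwards [eventually_lt_nhds hlt] with s hs using hS0 c s hs.le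
      rw [this.deriv_eq, deriv_const]
    · by_contra! hlt
      refine hr ?_
      have : S c =ᶠ[nhds r] fun _ => 1 := by
        filter_upwards [eventually_gt_nhds hlt] with s hs using hS1 c s hs.le
      rw [this.deriv_eq, deriv_const]
  have hlim : ∀ c, Filter.Tendsto (S c) Filter.atTop (nhds 1) := fun c =>
    tendsto_const_nhds.congr' (by
      filter_upwards [Filter.eventually_ge_atTop (c + ε)] with r hr using (hS1 c r hr).symm)
  have hint : ∀ c, IntegrableOn (deriv (S c)) (Set.Ioi 0) := fun c =>
    integrableOn_Ioi_deriv_of_nonneg' (fun r _ => hSd c r) (fun r _ => hSd0 c r) (hlim c)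
  have hval : ∀ c, 0 < c → ∫ r in Set.Ioi 0, deriv (S c) r = 1 := fun c hc => by
    rw [integral_Ioi_of_hasDerivAt_of_nonneg' (fun r _ => hSd c r) (fun r _ => hSd0 c r) (hlim c),
      hS0 c 0 hc.le, sub_zero]
  have hζd : ∀ r, deriv (fun r => S r₁ r - S r₂ r) r = deriv (S r₁) r - deriv (S r₂) r :=
    fun r => ((hSd r₁ r).sub (hSd r₂ r)).deriv
  -- The difference of the two steps is a nonnegative plateau supported in [r₁, r₂ + ε]. Testing
  -- with it yields 0 ≤ A - B, contradicting A < B.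
  obtain ⟨hi, h0⟩ := hG (fun r => S r₁ r - S r₂ r) (r₂ + ε) ((hS r₁).sub (hS r₂))
    (fun r => sub_nonneg.2 (Real.smoothTransition.monotone (by gcongr)))
    (fun r hr => by
      constructor
      · by_contra! hlt
        exact hr (by rw [hS0 _ _ hlt.le, hS0 _ _ (hlt.trans h).le, sub_zero])
      · by_contra! hlt
        exact hr (by rw [hS1 _ _ hlt.le, hS1 _ _ (by linarith), sub_self]))
  have hle : ∫ r in Set.Ioi 0, deriv (fun r => S r₁ r - S r₂ r) r * G r
      ≤ ∫ r in Set.Ioi 0, (A * deriv (S r₁) r - B * deriv (S r₂) r) := by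
    refine integral_mono hi (((hint r₁).const_mul _).sub ((hint r₂).const_mul _)) fun r => ?_
    simp only [hζd]
    have e1 : deriv (S r₁) r * G r ≤ A * deriv (S r₁) r := by
      rcases eq_or_ne (deriv (S r₁) r) 0 with h' | h'
      · simp [h']
      · have := hSs _ _ h'
        have hd : dist r r₁ < ε₁ := by rw [Real.dist_eq, abs_lt]; constructor <;> linarith
        rw [mul_comm]
        exact mul_le_mul_of_nonneg_right (h1 hd).le (hSd0 _ _)
    have e2 : B * deriv (S r₂) r ≤ deriv (S r₂) r * G r := by
      rcases eq_or_ne (deriv (S r₂) r) 0 with h' | h'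
      · simp [h']
      · have := hSs _ _ h'
        have hd : dist r r₂ < ε₂ := by rw [Real.dist_eq, abs_lt]; constructor <;> linarith
        rw [mul_comm (deriv (S r₂) r)]
        exact mul_le_mul_of_nonneg_right (h2 hd).le (hSd0 _ _)
    linarith
  rw [integral_sub ((hint r₁).const_mul _) ((hint r₂).const_mul _), integral_const_mul,
    integral_const_mul, hval r₁ h₀, hval r₂ (h₀.trans h)] at hle
  linarith

/-! ### The energy and its localization as integrals over the fixed cylinder ℝ × S². -/

theorem measurableEmbedding_slice {r : ℝ} (hr : 0 < r) :
    MeasurableEmbedding (fun z : ℝ × S2 => ((z.1, r • (z.2 : E3)) : Spacetime)) := by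
  have h1 : MeasurableEmbedding (fun ω : S2 => r • (ω : E3)) :=
    (measurableEmbedding_const_smul₀ hr.ne').comp
      (MeasurableEmbedding.subtype_coe Metric.isClosed_sphere.measurableSet)
  exact MeasurableEmbedding.id.prodMap h1

variable {Λ m : ℝ} {ψ : Spacetime → ℝ}

/-- The lapse cancels the factor √F of the slice volume, leaving only r². -/
theorem energy_eq_lintegral (hΛ : 0 < Λ) (hm : 0 < m) (hsub : 3 * m * √Λ < 1) {r : ℝ}
    (hr : cosmologicalRadius Λ m < r) :
    energy Λ m ψ r = ∫⁻ z, ENNReal.ofReal (r ^ 2 * energyDensity Λ m ψ (z.1, r • (z.2 : E3)))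
      ∂cylinderMeasure := by
  have hF := warp_pos hΛ hm hsub hr
  have hr0 : 0 < r := (cosmologicalRadius_pos hΛ hm hsub).trans hr
  have hs : 0 < √(warp Λ m r) := Real.sqrt_pos.2 hF
  rw [energy, sliceVolume, (measurableEmbedding_slice hr0).lintegral_map, lintegral_smul_measure,
    smul_eq_mul, ← lintegral_const_mul' _ _ ENNReal.ofReal_ne_top]
  refine lintegral_congr fun z => ?_
  rw [← ENNReal.ofReal_mul (by positivity), radius_slice hr0.le, lapse]
  congr 1
  field_simp

/-- The energy on the slice of radius `r`, localized by a cutoff in `t`. -/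
def localEnergy (Λ m : ℝ) (ψ : Spacetime → ℝ) (C R r : ℝ) : ℝ :=
  r ^ 2 * ∫ z, coneCutoff C R (z.1, r • (z.2 : E3)) * energyDensity Λ m ψ (z.1, r • (z.2 : E3))
    ∂cylinderMeasure

theorem continuousOn_localIntegrand (hΛ : 0 < Λ) (hm : 0 < m) (hsub : 3 * m * √Λ < 1)
    (hψ : IsWaveSolution Λ m ψ) (C R : ℝ) :
    ContinuousOn (fun y : ℝ × (ℝ × S2) => coneCutoff C R (y.2.1, y.1 • (y.2.2 : E3))
      * energyDensity Λ m ψ (y.2.1, y.1 • (y.2.2 : E3)))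
      (Set.Ioi (cosmologicalRadius Λ m) ×ˢ Set.univ) := by
  have hc : Continuous fun y : ℝ × (ℝ × S2) => ((y.2.1, y.1 • (y.2.2 : E3)) : Spacetime) := by
    fun_prop
  refine ((continuous_coneCutoff C R).comp hc).continuousOn.mul
    ((continuousOn_energyDensity hΛ hm hsub hψ).comp hc.continuousOn ?_)
  rintro ⟨r, z⟩ ⟨hr, -⟩
  have hr0 : 0 ≤ r := ((cosmologicalRadius_pos hΛ hm hsub).trans hr).le
  change cosmologicalRadius Λ m < radius (z.1, r • (z.2 : E3))
  rw [radius_slice hr0]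
  exact hr

theorem localIntegrand_eq_zero {C R : ℝ} (hC : 0 ≤ C) (r : ℝ) {z : ℝ × S2}
    (hz : z ∉ (Set.Icc (-R) R ×ˢ Set.univ : Set (ℝ × S2))) :
    coneCutoff C R (z.1, r • (z.2 : E3)) * energyDensity Λ m ψ (z.1, r • (z.2 : E3)) = 0 := by
  rw [coneCutoff_eq_zero hC, zero_mul]
  by_contra! h
  exact hz ⟨abs_le.1 h, trivial⟩

/-- The integrand is jointly continuous and vanishes for |t| > R, a support bound independent of r.
-/
theorem continuousOn_localEnergy (hΛ : 0 < Λ) (hm : 0 < m) (hsub : 3 * m * √Λ < 1)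
    (hψ : IsWaveSolution Λ m ψ) {C : ℝ} (hC : 0 ≤ C) (R : ℝ) :
    ContinuousOn (localEnergy Λ m ψ C R) (Set.Ioi (cosmologicalRadius Λ m)) := by
  refine (continuous_pow 2).continuousOn.mul ?_
  exact continuousOn_integral_of_compact_support
    (k := Set.Icc (-R) R ×ˢ Set.univ) (isCompact_Icc.prod isCompact_univ)
    (continuousOn_localIntegrand hΛ hm hsub hψ C R)
    fun r z _ hz => localIntegrand_eq_zero hC r hz

theorem localEnergy_le (hΛ : 0 < Λ) (hm : 0 < m) (hsub : 3 * m * √Λ < 1)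
    (hψ : IsWaveSolution Λ m ψ) {r₁ r₂ : ℝ} (h₁ : cosmologicalRadius Λ m < r₁) (h₂ : r₁ < r₂)
    (R : ℝ) : localEnergy Λ m ψ (warp Λ m r₁)⁻¹ R r₂ ≤ localEnergy Λ m ψ (warp Λ m r₁)⁻¹ R r₁ := by
  have hC : 0 ≤ (warp Λ m r₁)⁻¹ := (inv_pos.2 (warp_pos hΛ hm hsub h₁)).le
  have hG := continuousOn_localEnergy hΛ hm hsub hψ hC R
  have h₀ : 0 < r₁ := (cosmologicalRadius_pos hΛ hm hsub).trans h₁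
  refine le_of_forall_integral_deriv_mul_nonneg h₀ h₂ (hG.continuousAt (Ioi_mem_nhds h₁))
    (hG.continuousAt (Ioi_mem_nhds (h₁.trans h₂))) fun ζ b hζ hζ0 hζs => ?_
  obtain ⟨hi, h0⟩ := integral_deriv_mul_energyDensity_nonneg hΛ hm hsub hψ h₁ hζ hζ0 hζs R
  have hζ' : ∀ r, deriv ζ r ≠ 0 → r₁ ≤ r ∧ r ≤ b := fun r hr =>
    closure_minimal (fun r hr => hζs r hr) isClosed_Icc (support_deriv_subset hr)
  constructor
  · have hsupp : Function.support (fun r => deriv ζ r * localEnergy Λ m ψ (warp Λ m r₁)⁻¹ R r)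
        ⊆ Set.Icc r₁ b := fun r hr => hζ' r (left_ne_zero_of_mul hr)
    refine Integrable.integrableOn ((integrableOn_iff_integrable_of_support_subset hsupp).1 ?_)
    exact ((hζ.continuous_deriv le_rfl).continuousOn.mul
      (hG.mono fun r hr => h₁.trans_le hr.1)).integrableOn_Icc
  -- Since ζ' is constant on each slice, Fubini turns the spacetime inequality into one for
  -- `localEnergy`.
  · rw [integral_eq_integral_slices hi] at h0
    refine h0.trans_eq (setIntegral_congr_fun measurableSet_Ioi fun r hr => ?_)
    simp only [radius_slice (le_of_lt hr), integral_const_mul, localEnergy]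
    ring

theorem ofReal_localEnergy (hΛ : 0 < Λ) (hm : 0 < m) (hsub : 3 * m * √Λ < 1)
    (hψ : IsWaveSolution Λ m ψ) {C : ℝ} (hC : 0 ≤ C) (R : ℝ) {r : ℝ}
    (hr : cosmologicalRadius Λ m < r) :
    ENNReal.ofReal (localEnergy Λ m ψ C R r)
      = ∫⁻ z, ENNReal.ofReal (r ^ 2 * (coneCutoff C R (z.1, r • (z.2 : E3))
        * energyDensity Λ m ψ (z.1, r • (z.2 : E3)))) ∂cylinderMeasure := by
  have hr0 : 0 < r := (cosmologicalRadius_pos hΛ hm hsub).trans hr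
  have hc : Continuous fun z : ℝ × S2 => coneCutoff C R (z.1, r • (z.2 : E3))
      * energyDensity Λ m ψ (z.1, r • (z.2 : E3)) :=
    (continuousOn_localIntegrand hΛ hm hsub hψ C R).comp_continuous
      (f := fun z : ℝ × S2 => (r, z)) (by fun_prop) fun z => ⟨hr, trivial⟩
  have hi := hc.integrable_of_hasCompactSupport (μ := cylinderMeasure)
    (HasCompactSupport.intro (K := Set.Icc (-R) R ×ˢ Set.univ) (isCompact_Icc.prod isCompact_univ)
      fun z hz => localIntegrand_eq_zero hC r hz)
  rw [localEnergy, ← integral_const_mul]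
  refine ofReal_integral_eq_lintegral_ofReal (hi.const_mul _) (.of_forall fun z => ?_)
  have hF : 0 < warp Λ m (radius (z.1, r • (z.2 : E3))) := by
    rw [radius_slice hr0.le]
    exact warp_pos hΛ hm hsub hr
  have := coneCutoff_nonneg C R (z.1, r • (z.2 : E3))
  have := energyDensity_nonneg (ψ := ψ) hF
  positivity

theorem monotone_coneCutoff (C : ℝ) (q : Spacetime) : Monotone fun R => coneCutoff C R q := by
  intro R R' h
  exact mul_le_mul (Real.smoothTransition.monotone (by linarith))
    (Real.smoothTransition.monotone (by linarith)) (Real.smoothTransition.nonneg _)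
    (Real.smoothTransition.nonneg _)

end

end SdS

open SdS

/-! ### Removal of the cutoff. -/

theorem mainTheorem2 (Λ m : ℝ) (hΛ : 0 < Λ) (hm : 0 < m) (hsub : 3 * m * √Λ < 1)
    (ψ : SdS.Spacetime → ℝ) (hψ : SdS.IsWaveSolution Λ m ψ)
    (r₁ r₂ : ℝ) (h₁ : SdS.cosmologicalRadius Λ m < r₁) (h₂ : r₁ < r₂) :
    SdS.energy Λ m ψ r₂ ≤ SdS.energy Λ m ψ r₁ := by
  have hC : 0 ≤ (warp Λ m r₁)⁻¹ := (inv_pos.2 (warp_pos hΛ hm hsub h₁)).le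
  have h₂' := h₁.trans h₂
  have hpos : ∀ r, cosmologicalRadius Λ m < r → ∀ z : ℝ × S2,
      0 ≤ energyDensity Λ m ψ (z.1, r • (z.2 : E3)) := fun r hr z => by
    refine energyDensity_nonneg ?_
    rw [radius_slice ((cosmologicalRadius_pos hΛ hm hsub).trans hr).le]
    exact warp_pos hΛ hm hsub hr
  have hmeas : ∀ R, Measurable fun z : ℝ × S2 => ENNReal.ofReal (r₂ ^ 2 *
      (coneCutoff (warp Λ m r₁)⁻¹ R (z.1, r₂ • (z.2 : E3))
        * energyDensity Λ m ψ (z.1, r₂ • (z.2 : E3)))) := fun R =>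
    (measurable_const.mul ((continuousOn_localIntegrand hΛ hm hsub hψ _ R).comp_continuous
      (f := fun z : ℝ × S2 => (r₂, z)) (by fun_prop)
        fun z => ⟨h₂', trivial⟩).measurable).ennreal_ofReal
  have hlim := lintegral_tendsto_of_tendsto_of_monotone (μ := cylinderMeasure)
    (f := fun (n : ℕ) (z : ℝ × S2) => ENNReal.ofReal (r₂ ^ 2 *
      (coneCutoff (warp Λ m r₁)⁻¹ n (z.1, r₂ • (z.2 : E3))
        * energyDensity Λ m ψ (z.1, r₂ • (z.2 : E3)))))
    (F := fun z => ENNReal.ofReal (r₂ ^ 2 * energyDensity Λ m ψ (z.1, r₂ • (z.2 : E3))))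
    (fun n => (hmeas n).aemeasurable)
    (.of_forall fun z n k hnk => ENNReal.ofReal_le_ofReal (mul_le_mul_of_nonneg_left
      (mul_le_mul_of_nonneg_right (monotone_coneCutoff _ _ (Nat.cast_le.2 hnk)) (hpos r₂ h₂' z))
        (sq_nonneg _)))
    (.of_forall fun z => by
      refine tendsto_const_nhds.congr' ?_
      -- At a fixed point the cutoff equals 1 as soon as R exceeds this bound.
      obtain ⟨N, hN⟩ := exists_nat_ge
        (|z.1| + (warp Λ m r₁)⁻¹ * radius (z.1, r₂ • (z.2 : E3)) + 1)
      filter_upwards [Filter.eventually_ge_atTop N] with n hn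
      rw [coneCutoff_eq_one (hN.trans (Nat.cast_le.2 hn)), one_mul])
  rw [energy_eq_lintegral hΛ hm hsub h₂']
  -- It suffices to bound each localized energy at r₂. Monotonicity moves it to r₁, where the cutoff
  -- is simply bounded by 1, so the argument also covers infinite energies.
  refine le_of_tendsto' hlim fun n => ?_
  rw [← ofReal_localEnergy hΛ hm hsub hψ hC n h₂', energy_eq_lintegral hΛ hm hsub h₁]
  refine (ENNReal.ofReal_le_ofReal (localEnergy_le hΛ hm hsub hψ h₁ h₂ n)).trans ?_
  rw [ofReal_localEnergy hΛ hm hsub hψ hC n h₁]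
  exact lintegral_mono fun z => ENNReal.ofReal_le_ofReal (mul_le_mul_of_nonneg_left
    (mul_le_of_le_one_left (hpos r₁ h₁ z) (coneCutoff_le_one _ _ _)) (sq_nonneg _))
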